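/- Consider the linear program $\min c^{\mathsf T}x$ subject to $Ax=b,\ x\ge 0$, with $A\in\mathbb R^{m\times n}$ of rank $m$, and its dual $\max b^{\mathsf T}y$ subject to $A^{\mathsf T}y+s=c,\ s\ge 0$. Fix $\gamma\in(0,1)$ and $\sigma\in(0,4/5)$. For a triplet $(x,y,s)$ put $\mu=x^{\mathsf T}s/n$, $X=\mathrm{diag}(x)$, $S=\mathrm{diag}(s)$, $D=X^{1/2}S^{-1/2}$, and let $\mathcal N(\gamma)$ be the set of triplets with $x,s>0$, $Ax=b$, $A^{\mathsf T}y+s=c$ and $x_is_i\ge(1-\gamma)\mu$ for all $i$. A random matrix $W\in\mathbb R^{n\times w}$ is called a sketching matrix with accuracy $\zeta$ and failure probability $\delta$ if for each fixed matrix $Z$ with $n$ columns, with probability at least $1-\delta$, $$\|ZWW^{\mathsf T}Z^{\mathsf T}-ZZ^{\mathsf T}\|_2\le\tfrac{\zeta}{4}\Big(\|Z\|_2^2+\tfrac{\|Z\|_F^2}{m}\Big).$$ The long-step feasible interior point method starts at $(x^0,y^0,s^0)\in\mathcal N(\gamma)$ and, while $\mu_k>\mathrm{tol}$, does the following at the current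 iterate. 1. Draw a fresh independent sketching matrix $W$ with $\zeta=1/2$ and failure probability $\delta$, and put $Q=ADWW^{\mathsf T}DA^{\mathsf T}$ and $p=Ax-\sigma\mu AS^{-1}\mathbf 1$. 2. Run $t$ iterations of the conjugate gradient method, or of the Chebyshev iteration for the spectral interval $[(1+\zeta/2)^{-1},(1-\zeta/2)^{-1}]$, from $0$ on $Q^{-1/2}AD^2A^{\mathsf T}Q^{-1/2}z=Q^{-1/2}p$, and put $\hat{\Delta y}=Q^{-1/2}\tilde z^t$. 3. Put $v=(XS)^{1/2}W(ADW)^{\dagger}(AD^2A^{\mathsf T}\hat{\Delta y}-p)$, $\hat{\Delta s}=-A^{\mathsf T}\hat{\Delta y}$ and $\hat{\Delta x}=-x+\sigma\mu S^{-1}\mathbf 1-D^2\hat{\Delta s}-S^{-1}v$. 4. Let $\tilde\alpha$ be the largest $\alpha\in[0,1]$ for which $(x,y,s)+\alpha(\hat{\Delta x},\hat{\Delta y},\hat{\Delta s})\in\mathcal N(\gamma)$, let $\bar\alpha\in[0,\tilde\alpha]$ minimise $(x+\alpha\hat{\Delta x})^{\mathsf T}(s+\alpha\hat{\Delta s})$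 over $\alpha\in[0,\tilde\alpha]$, and move to $(x,y,s)+\bar\alpha(\hat{\Delta x},\hat{\Delta y},\hat{\Delta s})$. **Theorem.** There are constants $C_{\rm in},C_{\rm out},c_{\rm fail}>0$ depending only on $\gamma$ and $\sigma$ such that the following holds for either inner solver, all $m,n,w,A,b,c$ and all starting points in $\mathcal N(\gamma)$. Let $0<\epsilon\le 1$, $t\ge C_{\rm in}(1+\log n)$ (so $t=O(\log n)$ suffices), $\delta\le c_{\rm fail}/\big(n(1+\log(1/\epsilon))\big)$ (so $\delta=O(1/n)$ for constant $\epsilon$), and $\mathrm{tol}\ge\epsilon\mu_0$ (for instance $\mathrm{tol}=\epsilon\mu_0$, or $\mathrm{tol}=\epsilon$ if $\mu_0\le 1$). Then with probability at least $0.9$ the method stops after at most $\lceil C_{\rm out}\,n\log(1/\epsilon)\rceil=O(n\log(1/\epsilon))$ outer iterations at a point of $\mathcal N(\gamma)$ with $\mu_k\le\mathrm{tol}$. -/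

import Mathlib

open MeasureTheory ProbabilityTheory
open scoped Matrix

/-- Matrices carry the product (entrywise) sigma-algebra. -/
instance SketchedIPM.matrixMeasurableSpace (n w : ℕ) :
    MeasurableSpace (Matrix (Fin n) (Fin w) ℝ) :=
  inferInstanceAs (MeasurableSpace (Fin n → Fin w → ℝ))

namespace SketchedIPM

noncomputable section

/-! ### Linear algebra -/

/-- Spectral norm of a rectangular real matrix: the operator norm between Euclidean spaces. -/
def specNorm {a b : ℕ} (Z : Matrix (Fin a) (Fin b) ℝ) : ℝ :=
  ‖LinearMap.toContinuousLinearMap (Matrix.toEuclideanLin Z)‖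

/-- Squared Frobenius norm. -/
def frobSq {a b : ℕ} (Z : Matrix (Fin a) (Fin b) ℝ) : ℝ := ∑ i, ∑ j, Z i j ^ 2

/-- For `B = U Σ^{1/2} V^T`, the matrix `U Σ^{-1/2} U^T = (B B^T)^{-1/2}`, through the spectral
functional calculus of the symmetric matrix `B B^T`. (The eigenvalue `0`, which occurs only when
`B` does not have full row rank, is sent to `0`.) -/
def invSqrtGram {m w : ℕ} (B : Matrix (Fin m) (Fin w) ℝ) : Matrix (Fin m) (Fin m) ℝ :=
  cfc (fun x : ℝ => (√x)⁻¹) (B * Bᵀ)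

/-- The Moore-Penrose pseudoinverse `B^† = B^T (B B^T)^†` of a real matrix. -/
def pinv {m w : ℕ} (B : Matrix (Fin m) (Fin w) ℝ) : Matrix (Fin w) (Fin m) ℝ :=
  Bᵀ * cfc (fun x : ℝ => x⁻¹) (B * Bᵀ)

/-! ### Inner solvers for a symmetric positive definite system `M z = q`, started at `z = 0` -/

/-- Memory of conjugate gradients: current solution, residual `q - M z`, search direction. -/
structure CGState (m : ℕ) where
  z : Fin m → ℝ
  r : Fin m → ℝ
  d : Fin m → ℝ

/-- One iteration of the standard (Hestenes-Stiefel) conjugate gradient method. Once the residual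
is zero the state no longer moves, since `0 / 0 = 0`. -/
def cgStep {m : ℕ} (M : Matrix (Fin m) (Fin m) ℝ) (u : CGState m) : CGState m :=
  let a : ℝ := (u.r ⬝ᵥ u.r) / (u.d ⬝ᵥ (M *ᵥ u.d))
  let r' : Fin m → ℝ := u.r - a • (M *ᵥ u.d)
  let b : ℝ := (r' ⬝ᵥ r') / (u.r ⬝ᵥ u.r)
  { z := u.z + a • u.d, r := r', d := r' + b • u.d }

/-- The `t`-th conjugate gradient iterate for `M z = q`. -/
def cg {m : ℕ} (M : Matrix (Fin m) (Fin m) ℝ) (q : Fin m → ℝ) (t : ℕ) : Fin m → ℝ :=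
  ((cgStep M)^[t] ⟨0, q, q⟩).z

/-- Memory of the Chebyshev iteration: current solution, residual `q - M z`, increment, and the
ratio `T_k(θ/η) / T_{k+1}(θ/η)` of consecutive Chebyshev polynomials. -/
structure ChebState (m : ℕ) where
  z : Fin m → ℝ
  r : Fin m → ℝ
  d : Fin m → ℝ
  ρ : ℝ

/-- One Chebyshev iteration for a spectrum in `[lo, hi]`; `θ` is the centre of the interval and
`η` its half-length. -/
def chebStep {m : ℕ} (lo hi : ℝ) (M : Matrix (Fin m) (Fin m) ℝ) (u : ChebState m) :
    ChebState m :=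
  let θ : ℝ := (hi + lo) / 2
  let η : ℝ := (hi - lo) / 2
  let r' : Fin m → ℝ := u.r - M *ᵥ u.d
  let ρ' : ℝ := 1 / (2 * (θ / η) - u.ρ)
  { z := u.z + u.d, r := r', d := (ρ' * u.ρ) • u.d + (2 * ρ' / η) • r', ρ := ρ' }

/-- The `t`-th Chebyshev iterate for `M z = q`; its residual is
`T_t((θ - M)/η) q / T_t(θ/η)`. -/
def chebyshev {m : ℕ} (lo hi : ℝ) (M : Matrix (Fin m) (Fin m) ℝ) (q : Fin m → ℝ) (t : ℕ) :
    Fin m → ℝ :=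
  let θ : ℝ := (hi + lo) / 2
  let η : ℝ := (hi - lo) / 2
  ((chebStep lo hi M)^[t] ⟨0, q, θ⁻¹ • q, η / θ⟩).z

/-- The two admissible inner solvers. -/
inductive Solver where
  | conjugateGradient
  | chebyshevIteration

/-- Run `t` iterations of the chosen solver on `M z = q`. With accuracy parameter `ζ`, the
Chebyshev iteration uses the interval `[(1 + ζ/2)⁻¹, (1 - ζ/2)⁻¹]` for the spectrum. -/
def Solver.solve {m : ℕ} (alg : Solver) (ζ : ℝ) (M : Matrix (Fin m) (Fin m) ℝ)
    (q : Fin m → ℝ) (t : ℕ) : Fin m → ℝ :=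
  match alg with
  | .conjugateGradient => cg M q t
  | .chebyshevIteration => chebyshev (1 + ζ / 2)⁻¹ (1 - ζ / 2)⁻¹ M q t

/-! ### The linear program and its central-path neighbourhood -/

/-- Primal-dual triplets `(x, y, s)`. -/
abbrev Triplet (m n : ℕ) := (Fin n → ℝ) × (Fin m → ℝ) × (Fin n → ℝ)

/-- The duality measure `μ = x^T s / n`. -/
def dualityMeasure {m n : ℕ} (p : Triplet m n) : ℝ := (p.1 ⬝ᵥ p.2.2) / n

/-- Strictly feasible triplets for `min c^T x, A x = b, x ≥ 0` and its dual. -/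
def strictlyFeasible {m n : ℕ} (A : Matrix (Fin m) (Fin n) ℝ) (b : Fin m → ℝ)
    (c : Fin n → ℝ) : Set (Triplet m n) :=
  {p | (∀ i, 0 < p.1 i) ∧ (∀ i, 0 < p.2.2 i) ∧ A *ᵥ p.1 = b ∧ Aᵀ *ᵥ p.2.1 + p.2.2 = c}

/-- The neighbourhood `N(γ)` of the central path. -/
def neighborhood {m n : ℕ} (A : Matrix (Fin m) (Fin n) ℝ) (b : Fin m → ℝ)
    (c : Fin n → ℝ) (γ : ℝ) : Set (Triplet m n) :=
  {p | p ∈ strictlyFeasible A b c ∧ ∀ i, (1 - γ) * dualityMeasure p ≤ p.1 i * p.2.2 i}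

/-! ### One outer iteration -/

/-- The diagonal matrix `D = X^{1/2} S^{-1/2}`. -/
def scaling {m n : ℕ} (p : Triplet m n) : Matrix (Fin n) (Fin n) ℝ :=
  Matrix.diagonal fun i => √(p.1 i) / √(p.2.2 i)

/-- The coefficient matrix `A D² A^T` of the normal equations. -/
def normalMatrix {m n : ℕ} (A : Matrix (Fin m) (Fin n) ℝ) (p : Triplet m n) :
    Matrix (Fin m) (Fin m) ℝ :=
  A * (scaling p * scaling p) * Aᵀ

/-- The right-hand side `-σ μ A S⁻¹ 1 + A x` of the normal equations. -/
def normalRhs {m n : ℕ} (A : Matrix (Fin m) (Fin n) ℝ) (σ : ℝ) (p : Triplet m n) :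
    Fin m → ℝ :=
  A *ᵥ p.1 - (σ * dualityMeasure p) • (A *ᵥ fun i => (p.2.2 i)⁻¹)

/-- The approximate direction `Δy = Q^{-1/2} z`, where `Q = A D W W^T D A^T` and `z` is the
output of `t` iterations of the inner solver (with accuracy parameter `ζ`) on
`Q^{-1/2} A D² A^T Q^{-1/2} z = Q^{-1/2} p`. -/
def deltaY {m n w : ℕ} (A : Matrix (Fin m) (Fin n) ℝ) (σ ζ : ℝ) (alg : Solver) (t : ℕ)
    (W : Matrix (Fin n) (Fin w) ℝ) (p : Triplet m n) : Fin m → ℝ :=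
  let R := invSqrtGram (A * scaling p * W)
  R *ᵥ alg.solve ζ (R * normalMatrix A p * R) (R *ᵥ normalRhs A σ p) t

/-- The correction vector `v = (X S)^{1/2} W (A D W)^† (A D² A^T Δy - p)`. -/
def correction {m n w : ℕ} (A : Matrix (Fin m) (Fin n) ℝ) (σ ζ : ℝ) (alg : Solver) (t : ℕ)
    (W : Matrix (Fin n) (Fin w) ℝ) (p : Triplet m n) : Fin n → ℝ :=
  let residual := normalMatrix A p *ᵥ deltaY A σ ζ alg t W p - normalRhs A σ p
  let u := W *ᵥ (pinv (A * scaling p * W) *ᵥ residual)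
  fun i => √(p.1 i * p.2.2 i) * u i

/-- The search direction `(Δx, Δy, Δs)` with `Δs = -A^T Δy` and
`Δx = -x + σ μ S⁻¹ 1 - D² Δs - S⁻¹ v`. -/
def direction {m n w : ℕ} (A : Matrix (Fin m) (Fin n) ℝ) (σ ζ : ℝ) (alg : Solver) (t : ℕ)
    (W : Matrix (Fin n) (Fin w) ℝ) (p : Triplet m n) : Triplet m n :=
  let Δy := deltaY A σ ζ alg t W p
  let Δs : Fin n → ℝ := -(Aᵀ *ᵥ Δy)
  let v := correction A σ ζ alg t W p
  let Δx : Fin n → ℝ := fun i =>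
    -p.1 i + σ * dualityMeasure p / p.2.2 i - p.1 i / p.2.2 i * Δs i - v i / p.2.2 i
  (Δx, Δy, Δs)

/-- The largest step `α ∈ [0, 1]` that stays in the neighbourhood. -/
def maxStep {m n : ℕ} (A : Matrix (Fin m) (Fin n) ℝ) (b : Fin m → ℝ) (c : Fin n → ℝ)
    (γ : ℝ) (p dir : Triplet m n) : ℝ :=
  sSup {α : ℝ | α ∈ Set.Icc 0 1 ∧ p + α • dir ∈ neighborhood A b c γ}

/-- The step in `[0, amax]` that minimises the duality gap `(x + α Δx)^T (s + α Δs)` (the least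
minimiser, should there be several; a minimiser exists by compactness). -/
def stepSize {m n : ℕ} (amax : ℝ) (p dir : Triplet m n) : ℝ :=
  sInf {α : ℝ | α ∈ Set.Icc 0 amax ∧
    IsMinOn (fun β : ℝ => (p + β • dir).1 ⬝ᵥ (p + β • dir).2.2) (Set.Icc 0 amax) α}

/-- One outer iteration, performed with the sketching matrix `W`. -/
def outerStep {m n w : ℕ} (A : Matrix (Fin m) (Fin n) ℝ) (b : Fin m → ℝ) (c : Fin n → ℝ)
    (γ σ ζ : ℝ) (alg : Solver) (t : ℕ) (W : Matrix (Fin n) (Fin w) ℝ) (p : Triplet m n) :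
    Triplet m n :=
  let dir := direction A σ ζ alg t W p
  p + stepSize (maxStep A b c γ p dir) p dir • dir

open Classical in
/-- The long-step feasible interior point method with stopping test `μ ≤ tol`: the iterate after
`k` passes through the loop, where pass `k` uses the sketching matrix `W k`. Once the test is met
the loop has ended and the iterate stays. -/
def ipm {m n w : ℕ} (A : Matrix (Fin m) (Fin n) ℝ) (b : Fin m → ℝ) (c : Fin n → ℝ)
    (γ σ ζ : ℝ) (alg : Solver) (t : ℕ) (tol : ℝ) (W : ℕ → Matrix (Fin n) (Fin w) ℝ)
    (start : Triplet m n) : ℕ → Triplet m n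
  | 0 => start
  | k + 1 =>
    let p := ipm A b c γ σ ζ alg t tol W start k
    if tol < dualityMeasure p then outerStep A b c γ σ ζ alg t (W k) p else p

/-! ### Sketching matrices -/

/-- A random `n × w` matrix `W` is a sketching matrix with accuracy `ζ`, failure probability `δ`
and rank parameter `r` if, for each fixed matrix `Z` with `n` columns,
`‖Z W W^T Z^T - Z Z^T‖₂ ≤ (ζ/4) (‖Z‖₂² + ‖Z‖_F² / r)` with probability at least `1 - δ`. -/
def IsSketchingMatrix {Ω : Type*} [MeasurableSpace Ω] (P : Measure Ω) {n w : ℕ}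
    (W : Ω → Matrix (Fin n) (Fin w) ℝ) (ζ δ : ℝ) (r : ℕ) : Prop :=
  Measurable W ∧ ∀ (d : ℕ) (Z : Matrix (Fin d) (Fin n) ℝ),
    1 - δ ≤ P.real {ω | specNorm (Z * W ω * (W ω)ᵀ * Zᵀ - Z * Zᵀ) ≤
      ζ / 4 * (specNorm Z ^ 2 + frobSq Z / r)}

end

end SketchedIPM

open SketchedIPM

/-! Inexact inner solves do no harm to feasibility. When the sketch is good, the correction `v`
makes `A Δx = 0` hold exactly, and `v` survives only as a perturbation of the complementarity
equations `S Δx + X Δs = -XS1 + σμ1 - v`. The classical long-step analysis then goes through once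
every `|v i|` is at most `γσμ/4`. Since `Δx` is orthogonal to `Δs`, the duality measure is affine
along the step. A step of length of order `1/n` stays in the neighbourhood, and one pass multiplies
`μ` by at most `1 - decreaseRate γ σ / n` (`IsNewtonDirection.update`).

To see that `v` is small, put `B = A D`. A good sketch of the row space of `B` places the spectrum
of the preconditioned matrix in `[4/5, 4/3]` (`GoodSketch.preconditioned_bounds`), so either solver
brings the squared residual down to a `4 (2/5)^t` fraction (`Solver.residual_le`). Passing from this
residual to `v` costs only factors polynomial in `n`. One of them is a crude bound on `‖W‖`,
obtained by applying the sketching property to the identity matrix. Hence `t = O(log n)` inner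
iterations suffice (`GoodSketch.correction_bound`, `exists_outerStep_constant`).

The sketching guarantee concerns a fixed matrix, whereas `A D` depends on the earlier sketches. The
iterate is a measurable function of those sketches, hence independent of the fresh one, and Fubini
transfers the guarantee (`IsSketchingMatrix.measure_not_goodSketch_le_of_indepFun`). A union bound
over two events per pass finishes the argument. Measurability is the laborious ingredient: matrix
functions are limits of matrix polynomials, and step sizes are handled by projecting closed sets
along compact intervals. -/

namespace SketchedIPM

/-! ### Quadratic forms -/

section QuadraticForms

variable {m : ℕ} {M : Matrix (Fin m) (Fin m) ℝ}

theorem dotProduct_mulVec_symm (hM : M.IsSymm) (u v : Fin m → ℝ) :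
    u ⬝ᵥ M *ᵥ v = v ⬝ᵥ M *ᵥ u := by
  rw [Matrix.dotProduct_mulVec, ← Matrix.mulVec_transpose, hM.eq, dotProduct_comm]

theorem dotProduct_self_nonneg' {a : ℕ} (u : Fin a → ℝ) : 0 ≤ u ⬝ᵥ u :=
  Finset.sum_nonneg fun i _ => mul_self_nonneg (u i)

theorem dotProduct_sq_le {a : ℕ} (u v : Fin a → ℝ) : (u ⬝ᵥ v) ^ 2 ≤ (u ⬝ᵥ u) * (v ⬝ᵥ v) := by
  simpa only [dotProduct, ← pow_two] using Finset.sum_mul_sq_le_sq_mul_sq Finset.univ u v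

/-- Cauchy-Schwarz for a positive semidefinite form. -/
theorem form_sq_le (hM : M.IsSymm) (hpos : ∀ u, 0 ≤ u ⬝ᵥ M *ᵥ u) (u v : Fin m → ℝ) :
    (u ⬝ᵥ M *ᵥ v) ^ 2 ≤ (u ⬝ᵥ M *ᵥ u) * (v ⬝ᵥ M *ᵥ v) := by
  have key : ∀ x : ℝ, 0 ≤ (v ⬝ᵥ M *ᵥ v) * (x * x) + (2 * (u ⬝ᵥ M *ᵥ v)) * x
      + u ⬝ᵥ M *ᵥ u := by
    intro x
    have h := hpos (u + x • v)
    simp only [Matrix.mulVec_add, Matrix.mulVec_smul, dotProduct_add, add_dotProduct,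
      smul_dotProduct, dotProduct_smul, smul_eq_mul, dotProduct_mulVec_symm hM v u] at h
    linarith
  have := discrim_le_zero key
  rw [discrim] at this
  nlinarith

/-- This is `M² ≤ hi M` without diagonalisation: Cauchy-Schwarz for the form `M`, applied to `M u`
and `u`, followed by cancelling one factor `‖M u‖²`. -/
theorem mulVec_sq_le {hi : ℝ} (hM : M.IsSymm) (hpos : ∀ u, 0 ≤ u ⬝ᵥ M *ᵥ u)
    (hhi : ∀ u, u ⬝ᵥ M *ᵥ u ≤ hi * (u ⬝ᵥ u)) (u : Fin m → ℝ) :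
    (M *ᵥ u) ⬝ᵥ (M *ᵥ u) ≤ hi * (u ⬝ᵥ M *ᵥ u) := by
  rcases (dotProduct_self_nonneg' (M *ᵥ u)).eq_or_lt with h0 | h0
  · rw [← h0, dotProduct_self_eq_zero.mp h0.symm]; simp
  have h1 := form_sq_le hM hpos (M *ᵥ u) u
  rw [dotProduct_mulVec_symm hM (M *ᵥ u) u, ← dotProduct_mulVec_symm hM (M *ᵥ u) u] at h1
  have h2 := mul_le_mul_of_nonneg_right (hhi (M *ᵥ u)) (hpos u)
  refine le_of_mul_le_mul_left ?_ h0
  nlinarith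

/-- Euclidean Cauchy-Schwarz for `u` and `M u`, with `lo ‖u‖² ≤ u ⬝ᵥ M u` used to cancel `‖u‖²`. -/
theorem le_mulVec_sq {lo : ℝ} (hlo0 : 0 ≤ lo)
    (hlo : ∀ u, lo * (u ⬝ᵥ u) ≤ u ⬝ᵥ M *ᵥ u) (u : Fin m → ℝ) :
    lo * (u ⬝ᵥ M *ᵥ u) ≤ (M *ᵥ u) ⬝ᵥ (M *ᵥ u) := by
  rcases (dotProduct_self_nonneg' u).eq_or_lt with h0 | h0
  · rw [dotProduct_self_eq_zero.mp h0.symm]; simp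
  have h1 := dotProduct_sq_le u (M *ᵥ u)
  have h2 := hlo u
  have h3 : 0 ≤ u ⬝ᵥ M *ᵥ u := le_trans (by positivity) h2
  refine le_of_mul_le_mul_left ?_ h0
  nlinarith [mul_le_mul_of_nonneg_right h2 h3]

end QuadraticForms

/-! ### Convergence of the inner solvers -/

section Solvers

variable {m : ℕ} {M : Matrix (Fin m) (Fin m) ℝ}

/-- The relations between residual and search direction that conjugate gradients maintain. -/
structure CGInvariant (M : Matrix (Fin m) (Fin m) ℝ) (q : Fin m → ℝ) (u : CGState m) : Prop where
  residual : u.r = q - M *ᵥ u.z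
  slope : u.d ⬝ᵥ u.r = u.r ⬝ᵥ u.r
  conj : u.r ⬝ᵥ M *ᵥ u.d = u.d ⬝ᵥ M *ᵥ u.d

theorem cgStep_eq_of_residual_eq_zero {u : CGState m} (h : u.r = 0) :
    cgStep M u = ⟨u.z, 0, 0⟩ := by
  simp [cgStep, h]

/-- The step length `a` makes the new residual orthogonal to the old direction and, by conjugacy, to
the old residual. The coefficient `b` then makes the new direction `M`-conjugate to the old one.
These local relations suffice for a one-step energy estimate; full orthogonality of the Krylov basis
is not needed. -/
theorem CGInvariant.step {lo : ℝ} {q : Fin m → ℝ} {u : CGState m} (hM : M.IsSymm) (hlo0 : 0 < lo)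
    (hlo : ∀ u, lo * (u ⬝ᵥ u) ≤ u ⬝ᵥ M *ᵥ u) (h : CGInvariant M q u) :
    CGInvariant M q (cgStep M u) := by
  obtain ⟨h1, h2, h3⟩ := h
  by_cases hr : u.r = 0
  · rw [cgStep_eq_of_residual_eq_zero hr]
    exact ⟨by simp only; rw [← h1, hr], by simp, by simp⟩
  have hrr : 0 < u.r ⬝ᵥ u.r :=
    lt_of_le_of_ne (dotProduct_self_nonneg' _) fun h => hr (dotProduct_self_eq_zero.mp h.symm)
  have hd : u.d ≠ 0 := by
    intro h; rw [h, zero_dotProduct] at h2; exact hrr.ne h2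
  have hdd : 0 < u.d ⬝ᵥ u.d :=
    lt_of_le_of_ne (dotProduct_self_nonneg' _) fun h => hd (dotProduct_self_eq_zero.mp h.symm)
  have hdMd : 0 < u.d ⬝ᵥ M *ᵥ u.d := lt_of_lt_of_le (by positivity) (hlo _)
  set a : ℝ := (u.r ⬝ᵥ u.r) / (u.d ⬝ᵥ (M *ᵥ u.d)) with ha
  set r' : Fin m → ℝ := u.r - a • (M *ᵥ u.d) with hr'
  set b : ℝ := (r' ⬝ᵥ r') / (u.r ⬝ᵥ u.r) with hb
  have hstep : cgStep M u = ⟨u.z + a • u.d, r', r' + b • u.d⟩ := rfl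
  have haM : a * (u.d ⬝ᵥ M *ᵥ u.d) = u.r ⬝ᵥ u.r := by rw [ha]; field_simp
  have hbr : b * (u.r ⬝ᵥ u.r) = r' ⬝ᵥ r' := by rw [hb]; field_simp
  have hapos : a ≠ 0 := by rw [ha]; positivity
  have e1 : r' ⬝ᵥ u.d = 0 := by
    rw [hr', sub_dotProduct, smul_dotProduct, smul_eq_mul, dotProduct_comm (M *ᵥ u.d), haM,
      dotProduct_comm, h2, sub_self]
  have e2 : r' ⬝ᵥ u.r = 0 := by
    rw [hr', sub_dotProduct, smul_dotProduct, smul_eq_mul, dotProduct_comm (M *ᵥ u.d), h3, haM,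
      sub_self]
  have e3 : a * (r' ⬝ᵥ M *ᵥ u.d) = -(r' ⬝ᵥ r') := by
    have : r' ⬝ᵥ r' = r' ⬝ᵥ u.r - a * (r' ⬝ᵥ M *ᵥ u.d) := by
      conv_lhs => rw [hr', dotProduct_sub, dotProduct_smul, smul_eq_mul, ← hr']
    linarith
  -- Conjugacy of the old and the new direction.
  have e4 : r' ⬝ᵥ M *ᵥ u.d + b * (u.d ⬝ᵥ M *ᵥ u.d) = 0 := by
    have : a * (r' ⬝ᵥ M *ᵥ u.d + b * (u.d ⬝ᵥ M *ᵥ u.d)) = 0 := by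
      linear_combination e3 + b * haM + hbr
    exact (mul_eq_zero.mp this).resolve_left hapos
  rw [hstep]
  refine ⟨?_, ?_, ?_⟩
  · simp only [Matrix.mulVec_add, Matrix.mulVec_smul]
    rw [hr', h1]; abel
  · simp only [add_dotProduct, smul_dotProduct, smul_eq_mul]
    rw [dotProduct_comm u.d, e1]; ring
  · simp only [Matrix.mulVec_add, Matrix.mulVec_smul, dotProduct_add, add_dotProduct,
      smul_dotProduct, dotProduct_smul, smul_eq_mul, dotProduct_mulVec_symm hM u.d r']
    linear_combination (-b) * e4

/-- One conjugate gradient step contracts the energy norm of the error. -/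
theorem CGInvariant.energy_step {lo hi : ℝ} {q e : Fin m → ℝ} {u : CGState m} (hM : M.IsSymm)
    (hlo0 : 0 < lo) (hhi0 : 0 < hi) (hlo : ∀ u, lo * (u ⬝ᵥ u) ≤ u ⬝ᵥ M *ᵥ u)
    (hhi : ∀ u, u ⬝ᵥ M *ᵥ u ≤ hi * (u ⬝ᵥ u)) (h : CGInvariant M q u)
    (he : M *ᵥ e = q) :
    (e - (cgStep M u).z) ⬝ᵥ M *ᵥ (e - (cgStep M u).z) ≤
      (1 - lo / hi) * ((e - u.z) ⬝ᵥ M *ᵥ (e - u.z)) := by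
  obtain ⟨h1, h2, h3⟩ := h
  set f := e - u.z with hf
  have hMf : M *ᵥ f = u.r := by rw [hf, Matrix.mulVec_sub, he, h1]
  have hpos : ∀ u, 0 ≤ u ⬝ᵥ M *ᵥ u := fun u =>
    le_trans (mul_nonneg hlo0.le (dotProduct_self_nonneg' u)) (hlo u)
  by_cases hr : u.r = 0
  · rw [cgStep_eq_of_residual_eq_zero hr]
    simp only [← hf, hMf, hr]; simp
  have hrr : 0 < u.r ⬝ᵥ u.r :=
    lt_of_le_of_ne (dotProduct_self_nonneg' _) fun h => hr (dotProduct_self_eq_zero.mp h.symm)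
  have hd : u.d ≠ 0 := by
    intro h; rw [h, zero_dotProduct] at h2; exact hrr.ne h2
  have hdd : 0 < u.d ⬝ᵥ u.d :=
    lt_of_le_of_ne (dotProduct_self_nonneg' _) fun h => hd (dotProduct_self_eq_zero.mp h.symm)
  have hdMd : 0 < u.d ⬝ᵥ M *ᵥ u.d := lt_of_lt_of_le (by positivity) (hlo _)
  set a : ℝ := (u.r ⬝ᵥ u.r) / (u.d ⬝ᵥ (M *ᵥ u.d)) with ha
  have hz : e - (cgStep M u).z = f - a • u.d := by
    change e - (u.z + a • u.d) = _
    rw [hf]; abel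
  have haM : a * (u.d ⬝ᵥ M *ᵥ u.d) = u.r ⬝ᵥ u.r := by rw [ha]; field_simp
  have hdr : u.d ⬝ᵥ M *ᵥ f = u.r ⬝ᵥ u.r := by rw [hMf, h2]
  -- By conjugacy the energy of `r - d` is `r ⬝ᵥ M r - d ⬝ᵥ M d`. Hence the step length is at least
  -- `1 / hi`, that of gradient descent.
  have hle : u.d ⬝ᵥ M *ᵥ u.d ≤ u.r ⬝ᵥ M *ᵥ u.r := by
    have := hpos (u.r - u.d)
    simp only [Matrix.mulVec_sub, dotProduct_sub, sub_dotProduct,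
      dotProduct_mulVec_symm hM u.d u.r, h3] at this
    linarith
  have hle2 : u.d ⬝ᵥ M *ᵥ u.d ≤ hi * (u.r ⬝ᵥ u.r) := hle.trans (hhi _)
  have hlow : lo * (f ⬝ᵥ M *ᵥ f) ≤ u.r ⬝ᵥ u.r := by
    have := le_mulVec_sq hlo0.le hlo f
    rwa [hMf] at this ⊢
  have ha1 : 1 / hi ≤ a := by
    rw [ha, div_le_div_iff₀ hhi0 hdMd]; linarith
  rw [hz]
  simp only [Matrix.mulVec_sub, Matrix.mulVec_smul, dotProduct_sub, sub_dotProduct,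
    smul_dotProduct, dotProduct_smul, smul_eq_mul, dotProduct_mulVec_symm hM f u.d, hdr, haM]
  -- The energy drops by exactly `a ‖r‖²`, so this bound is all that remains.
  have h5 : lo / hi * (f ⬝ᵥ M *ᵥ f) ≤ a * (u.r ⬝ᵥ u.r) :=
    calc lo / hi * (f ⬝ᵥ M *ᵥ f) = 1 / hi * (lo * (f ⬝ᵥ M *ᵥ f)) := by ring
      _ ≤ 1 / hi * (u.r ⬝ᵥ u.r) := by gcongr
      _ ≤ _ := by gcongr
  linarith

/-- The energy of the error contracts by `1 - lo / hi` per step; comparing energy with squared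
residual at both ends costs the factor `hi / lo`. This is the gradient descent rate, which is enough
here because the condition number is a constant. -/
theorem cg_residual_le {lo hi : ℝ} (hM : M.IsSymm) (hlo0 : 0 < lo) (hlohi : lo ≤ hi)
    (hlo : ∀ u, lo * (u ⬝ᵥ u) ≤ u ⬝ᵥ M *ᵥ u) (hhi : ∀ u, u ⬝ᵥ M *ᵥ u ≤ hi * (u ⬝ᵥ u))
    (q : Fin m → ℝ) (t : ℕ) :
    (q - M *ᵥ cg M q t) ⬝ᵥ (q - M *ᵥ cg M q t) ≤
      hi / lo * (1 - lo / hi) ^ t * (q ⬝ᵥ q) := by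
  have hhi0 : 0 < hi := hlo0.trans_le hlohi
  have hpos : ∀ u, 0 ≤ u ⬝ᵥ M *ᵥ u := fun u =>
    le_trans (mul_nonneg hlo0.le (dotProduct_self_nonneg' u)) (hlo u)
  have hinj : Function.Injective M.mulVecLin := by
    rw [← LinearMap.ker_eq_bot, LinearMap.ker_eq_bot']
    intro u hu
    have h := hlo u
    rw [Matrix.mulVecLin_apply] at hu
    rw [hu, dotProduct_zero] at h
    exact dotProduct_self_eq_zero.mp (le_antisymm (by nlinarith) (dotProduct_self_nonneg' u))
  obtain ⟨e, he⟩ := (LinearMap.injective_iff_surjective.mp hinj) q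
  rw [Matrix.mulVecLin_apply] at he
  have key : ∀ t : ℕ, CGInvariant M q ((cgStep M)^[t] ⟨0, q, q⟩) ∧
      (e - ((cgStep M)^[t] ⟨0, q, q⟩).z) ⬝ᵥ M *ᵥ (e - ((cgStep M)^[t] ⟨0, q, q⟩).z) ≤
        (1 - lo / hi) ^ t * (e ⬝ᵥ M *ᵥ e) := by
    intro t
    induction t with
    | zero => exact ⟨⟨by simp, by simp, by simp⟩, by simp⟩
    | succ t ih =>
      rw [Function.iterate_succ_apply']
      refine ⟨ih.1.step hM hlo0 hlo, ?_⟩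
      refine (ih.1.energy_step hM hlo0 hhi0 hlo hhi he).trans ?_
      have h0 : 0 ≤ 1 - lo / hi := by
        rw [sub_nonneg, div_le_one hhi0]; exact hlohi
      calc _ ≤ (1 - lo / hi) * ((1 - lo / hi) ^ t * (e ⬝ᵥ M *ᵥ e)) :=
            mul_le_mul_of_nonneg_left ih.2 h0
        _ = _ := by ring
  have h1 := (key t).2
  change (e - cg M q t) ⬝ᵥ M *ᵥ (e - cg M q t) ≤ _ at h1
  have h2 : q - M *ᵥ cg M q t = M *ᵥ (e - cg M q t) := by rw [Matrix.mulVec_sub, he]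
  have h3 := mulVec_sq_le hM hpos hhi (e - cg M q t)
  have h4 := le_mulVec_sq hlo0.le hlo e
  have h0 : 0 ≤ 1 - lo / hi := by
    rw [sub_nonneg, div_le_one hhi0]; exact hlohi
  rw [h2]
  refine h3.trans ?_
  rw [he] at h1 h4
  have h5 : e ⬝ᵥ q ≤ 1 / lo * (q ⬝ᵥ q) := by
    rw [div_mul_eq_mul_div, one_mul, le_div_iff₀ hlo0]; linarith
  calc hi * ((e - cg M q t) ⬝ᵥ M *ᵥ (e - cg M q t))
      ≤ hi * ((1 - lo / hi) ^ t * (1 / lo * (q ⬝ᵥ q))) := by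
        gcongr
        exact h1.trans (by gcongr)
    _ = _ := by ring

/-- The relations maintained by the Chebyshev iteration after `k` steps. Here `τ` and `τ'` are
the values of two consecutive Chebyshev polynomials at `κ = θ / η`, so that `τ • r` and
`τ' • (r - M d)` are consecutive terms of the three-term recurrence with the matrix
`(θ - M) / η`. -/
structure ChebInvariant (κ η : ℝ) (M : Matrix (Fin m) (Fin m) ℝ) (q : Fin m → ℝ) (k : ℕ)
    (τ τ' : ℝ) (u : ChebState m) : Prop where
  residual : u.r = q - M *ᵥ u.z
  ratio : u.ρ = τ / τ'
  growth : κ ^ k ≤ τ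
  growth' : κ * τ ≤ τ'
  size : (τ • u.r) ⬝ᵥ (τ • u.r) ≤ ((k + 1 : ℝ) ^ 2) * (q ⬝ᵥ q)
  energy : ∀ B : Matrix (Fin m) (Fin m) ℝ, B = κ • 1 - η⁻¹ • M →
    (τ' • (u.r - M *ᵥ u.d) - B *ᵥ (τ • u.r)) ⬝ᵥ (τ' • (u.r - M *ᵥ u.d) - B *ᵥ (τ • u.r))
      + (τ • u.r) ⬝ᵥ (τ • u.r) - (B *ᵥ (τ • u.r)) ⬝ᵥ (B *ᵥ (τ • u.r)) ≤ q ⬝ᵥ q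

theorem dotProduct_add_self_le {a : ℕ} {u v : Fin a → ℝ} {s t c : ℝ} (hs : 0 ≤ s) (ht : 0 ≤ t)
    (hc : 0 ≤ c) (hu : u ⬝ᵥ u ≤ s ^ 2 * c) (hv : v ⬝ᵥ v ≤ t ^ 2 * c) :
    (u + v) ⬝ᵥ (u + v) ≤ (s + t) ^ 2 * c := by
  have h1 := dotProduct_sq_le u v
  have h2 : u ⬝ᵥ v ≤ s * t * c := by
    refine le_of_sq_le_sq ?_ (by positivity)
    calc (u ⬝ᵥ v) ^ 2 ≤ _ := h1
      _ ≤ (s ^ 2 * c) * (t ^ 2 * c) :=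
        mul_le_mul hu hv (dotProduct_self_nonneg' v) (by positivity)
      _ = _ := by ring
  simp only [add_dotProduct, dotProduct_add, dotProduct_comm v u]
  linarith

/-- With `v = T_k(B) q` and `w = T_{k+1}(B) q`, the quantity `‖w‖² - 2 w ⬝ᵥ B v + ‖v‖²` is conserved
by the recurrence `(v, w) ↦ (w, 2 B w - v)`; this is the Pell identity for Chebyshev polynomials. As
`B` is a contraction, it yields `‖w - B v‖ ≤ ‖q‖`, so `‖w‖ ≤ ‖v‖ + ‖q‖`. The resulting linear growth
replaces the sharp bound `|T_k| ≤ 1` and needs no spectral theorem. -/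
theorem ChebInvariant.step {lo hi κ η τ τ' : ℝ} {q : Fin m → ℝ} {k : ℕ} {u : ChebState m}
    (hη : η = (hi - lo) / 2) (hη0 : 0 < η) (hκ : κ = (hi + lo) / 2 / η) (hκ1 : 1 ≤ κ)
    (hM : M.IsSymm)
    (hB : ∀ B : Matrix (Fin m) (Fin m) ℝ, B = κ • 1 - η⁻¹ • M →
      ∀ u, (B *ᵥ u) ⬝ᵥ (B *ᵥ u) ≤ u ⬝ᵥ u)
    (h : ChebInvariant κ η M q k τ τ' u) :
    ChebInvariant κ η M q (k + 1) τ' (2 * κ * τ' - τ) (chebStep lo hi M u) := by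
  obtain ⟨h1, h2, h3, h4, h5, h6⟩ := h
  have hκ0 : 0 < κ := by linarith
  have hτ : 0 < τ := lt_of_lt_of_le (by positivity) h3
  have hττ : τ ≤ τ' := le_trans (by nlinarith) h4
  have hτ' : 0 < τ' := by linarith
  have hτ'' : κ * τ' ≤ 2 * κ * τ' - τ := by nlinarith
  have hτ''0 : 0 < 2 * κ * τ' - τ := lt_of_lt_of_le (by positivity) hτ''
  set r' : Fin m → ℝ := u.r - M *ᵥ u.d with hr'
  set ρ' : ℝ := 1 / (2 * κ - u.ρ) with hρ'
  have hρ : ρ' = τ' / (2 * κ * τ' - τ) := by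
    have : 2 * κ - u.ρ = (2 * κ * τ' - τ) / τ' := by rw [h2]; field_simp
    rw [hρ', this, one_div_div]
  have hstep : chebStep lo hi M u =
      ⟨u.z + u.d, r', (ρ' * u.ρ) • u.d + (2 * ρ' / η) • r', ρ'⟩ := by
    simp only [chebStep, hρ', hκ, hη, hr']
  set B : Matrix (Fin m) (Fin m) ℝ := κ • 1 - η⁻¹ • M with hBdef
  have hBs : B.IsSymm := by
    rw [hBdef, Matrix.IsSymm, Matrix.transpose_sub, Matrix.transpose_smul, Matrix.transpose_smul,
      Matrix.transpose_one, hM.eq]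
  have h6' := h6 B rfl
  have hBv : ∀ v, B *ᵥ v = κ • v - η⁻¹ • (M *ᵥ v) := fun v => by
    rw [hBdef, Matrix.sub_mulVec, Matrix.smul_mulVec, Matrix.smul_mulVec, Matrix.one_mulVec]
  rw [hstep]
  refine ⟨?_, hρ, ?_, hτ'', ?_, ?_⟩
  · simp only [Matrix.mulVec_add]; rw [hr', h1]; abel
  · rw [pow_succ']
    exact le_trans (mul_le_mul_of_nonneg_left h3 hκ0.le) h4
  · have hB1 := hB B rfl (τ • u.r)
    have e : τ' • r' = B *ᵥ (τ • u.r) + (τ' • r' - B *ᵥ (τ • u.r)) := by abel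
    simp only
    rw [e]
    push_cast
    refine dotProduct_add_self_le (by positivity) zero_le_one (dotProduct_self_nonneg' q)
      (hB1.trans h5) (by linarith)
  · intro B' hB'
    rw [← hBdef] at hB'
    subst hB'
    simp only
    -- The recursion for `ρ` is what turns the update into the three-term Chebyshev recurrence for
    -- rescaled residuals.
    have hw : (2 * κ * τ' - τ) • (r' - M *ᵥ ((ρ' * u.ρ) • u.d + (2 * ρ' / η) • r')) =
        (2 : ℝ) • (B *ᵥ (τ' • r')) - τ • u.r := by
      have hMd : M *ᵥ u.d = u.r - r' := by rw [hr']; abel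
      rw [Matrix.mulVec_add, Matrix.mulVec_smul, Matrix.mulVec_smul, hMd, hBv, Matrix.mulVec_smul,
        hρ, h2]
      ext i
      simp only [Pi.smul_apply, Pi.sub_apply, Pi.add_apply, smul_eq_mul]
      field_simp
      ring
    rw [hw]
    have hsymm := dotProduct_mulVec_symm hBs (τ • u.r) (τ' • r')
    generalize τ • u.r = v at *
    generalize τ' • r' = w at *
    have e2 : (2 : ℝ) • B *ᵥ w - v - B *ᵥ w = B *ᵥ w - v := by rw [two_smul]; abel
    rw [e2]
    simp only [sub_dotProduct, dotProduct_sub] at h6' ⊢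
    rw [dotProduct_comm (B *ᵥ v) w] at h6'
    rw [dotProduct_comm (B *ᵥ w) v]
    linarith

theorem chebyshev_residual_le {lo hi : ℝ} (hM : M.IsSymm) (hlo0 : 0 < lo) (hlohi : lo < hi)
    (hlo : ∀ u, lo * (u ⬝ᵥ u) ≤ u ⬝ᵥ M *ᵥ u) (hhi : ∀ u, u ⬝ᵥ M *ᵥ u ≤ hi * (u ⬝ᵥ u))
    (q : Fin m → ℝ) (t : ℕ) :
    (((hi + lo) / (hi - lo)) ^ t) ^ 2 *
      ((q - M *ᵥ chebyshev lo hi M q t) ⬝ᵥ (q - M *ᵥ chebyshev lo hi M q t)) ≤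
      (t + 1 : ℝ) ^ 2 * (q ⬝ᵥ q) := by
  obtain ⟨η, hη⟩ : ∃ η : ℝ, η = (hi - lo) / 2 := ⟨_, rfl⟩
  obtain ⟨κ, hκ⟩ : ∃ κ : ℝ, κ = (hi + lo) / 2 / η := ⟨_, rfl⟩
  have hη0 : 0 < η := by rw [hη]; linarith
  have hκ1 : 1 ≤ κ := by rw [hκ, one_le_div hη0, hη]; linarith
  have hκη : κ * η = (hi + lo) / 2 := by rw [hκ]; field_simp
  have hBv : ∀ v, (κ • (1 : Matrix (Fin m) (Fin m) ℝ) - η⁻¹ • M) *ᵥ v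
      = κ • v - η⁻¹ • (M *ᵥ v) := fun v => by
    rw [Matrix.sub_mulVec, Matrix.smul_mulVec, Matrix.smul_mulVec, Matrix.one_mulVec]
  have hB : ∀ B : Matrix (Fin m) (Fin m) ℝ, B = κ • 1 - η⁻¹ • M →
      ∀ u, (B *ᵥ u) ⬝ᵥ (B *ᵥ u) ≤ u ⬝ᵥ u := by
    rintro _ rfl u
    have hNv : ∀ v, (M - lo • (1 : Matrix (Fin m) (Fin m) ℝ)) *ᵥ v = M *ᵥ v - lo • v :=
      fun v => by rw [Matrix.sub_mulVec, Matrix.smul_mulVec, Matrix.one_mulVec]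
    -- `(M - lo)² ≤ (hi - lo)(M - lo)` is a rewriting of `(θ - M)² ≤ η²`, that is, of the
    -- contractivity of `B = (θ - M) / η`.
    have hN := mulVec_sq_le (M := M - lo • 1) (hi := hi - lo)
      (by rw [Matrix.IsSymm, Matrix.transpose_sub, Matrix.transpose_smul, Matrix.transpose_one,
            hM.eq])
      (fun v => by
        rw [hNv, dotProduct_sub, dotProduct_smul, smul_eq_mul]; linarith [hlo v])
      (fun v => by
        rw [hNv, dotProduct_sub, dotProduct_smul, smul_eq_mul]; linarith [hhi v]) u
    rw [hNv] at hN
    rw [hBv]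
    have e : κ • u - η⁻¹ • (M *ᵥ u) = η⁻¹ • (((hi + lo) / 2) • u - M *ᵥ u) := by
      rw [smul_sub, smul_smul, ← hκη]; congr 2; field_simp
    rw [e, smul_dotProduct, dotProduct_smul, smul_eq_mul, smul_eq_mul, ← mul_assoc, ← mul_inv,
      inv_mul_le_iff₀ (by positivity), hη]
    simp only [sub_dotProduct, dotProduct_sub, smul_dotProduct, dotProduct_smul, smul_eq_mul,
      dotProduct_comm (M *ᵥ u) u] at hN ⊢
    nlinarith
  have key : ∀ t : ℕ, ∃ τ τ' : ℝ, ChebInvariant κ η M q t τ τ'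
      ((chebStep lo hi M)^[t] ⟨0, q, ((hi + lo) / 2)⁻¹ • q, η / ((hi + lo) / 2)⟩) := by
    intro t
    induction t with
    | zero =>
      refine ⟨1, κ, by simp, ?_, by simp, by simp, by simp, ?_⟩
      · simp only [Function.iterate_zero, id]; rw [hκ, one_div_div]
      · rintro _ rfl
        simp only [Function.iterate_zero, id, one_smul]
        have : κ • (q - M *ᵥ ((hi + lo) / 2)⁻¹ • q) =
            (κ • (1 : Matrix (Fin m) (Fin m) ℝ) - η⁻¹ • M) *ᵥ q := by
          rw [hBv, Matrix.mulVec_smul, smul_sub, smul_smul, ← hκη]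
          congr 2; field_simp
        rw [this, sub_self, zero_dotProduct]
        linarith [dotProduct_self_nonneg' ((κ • (1 : Matrix (Fin m) (Fin m) ℝ) - η⁻¹ • M) *ᵥ q)]
    | succ t ih =>
      obtain ⟨τ, τ', h⟩ := ih
      rw [Function.iterate_succ_apply']
      exact ⟨_, _, h.step hη hη0 hκ hκ1 hM hB⟩
  obtain ⟨τ, τ', h⟩ := key t
  have hz : ((chebStep lo hi M)^[t]
      ⟨0, q, ((hi + lo) / 2)⁻¹ • q, η / ((hi + lo) / 2)⟩).z = chebyshev lo hi M q t := by
    rw [hη]; rfl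
  have h1 := h.size
  rw [h.residual, hz, smul_dotProduct, dotProduct_smul, smul_eq_mul, smul_eq_mul, ← mul_assoc,
    ← pow_two] at h1
  refine le_trans (mul_le_mul_of_nonneg_right ?_ (dotProduct_self_nonneg' _)) h1
  have : (hi + lo) / (hi - lo) = κ := by rw [hκ, hη]; field_simp
  rw [this]
  have := h.growth
  gcongr

/-- Both inner solvers reduce the residual geometrically when the spectrum of the coefficient
matrix lies in `[4/5, 4/3]`. -/
theorem Solver.residual_le (alg : Solver) (hM : M.IsSymm)
    (hlo : ∀ u, 4 / 5 * (u ⬝ᵥ u) ≤ u ⬝ᵥ M *ᵥ u) (hhi : ∀ u, u ⬝ᵥ M *ᵥ u ≤ 4 / 3 * (u ⬝ᵥ u))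
    (q : Fin m → ℝ) (t : ℕ) :
    (q - M *ᵥ alg.solve (1 / 2) M q t) ⬝ᵥ (q - M *ᵥ alg.solve (1 / 2) M q t) ≤
      4 * (2 / 5) ^ t * (q ⬝ᵥ q) := by
  have hq := dotProduct_self_nonneg' q
  cases alg with
  | conjugateGradient =>
    -- Here `1 - lo / hi = 2 / 5` and `hi / lo = 5 / 3 ≤ 4`.
    have h := cg_residual_le hM (by norm_num) (by norm_num) hlo hhi q t
    refine h.trans ?_
    norm_num
    gcongr
    norm_num
  | chebyshevIteration =>
    have h := chebyshev_residual_le hM (by norm_num) (by norm_num) hlo hhi q t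
    have e : Solver.chebyshevIteration.solve (1 / 2) M q t = chebyshev (4 / 5) (4 / 3) M q t := by
      rw [Solver.solve]; norm_num
    rw [e]
    -- The Chebyshev growth factor is `4`, and `(t + 1)² ≤ 4^t` absorbs the linear growth: `(t + 1)²
    -- / 16^t ≤ (1/4)^t ≤ (2/5)^t`.
    rw [show ((4 / 3 + 4 / 5 : ℝ) / (4 / 3 - 4 / 5)) = 4 by norm_num] at h
    have h2 : (t + 1 : ℝ) ^ 2 ≤ (2 ^ t) ^ 2 := by
      have : t + 1 ≤ 2 ^ t := Nat.lt_two_pow_self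
      have : (t + 1 : ℝ) ≤ 2 ^ t := by exact_mod_cast this
      gcongr
    have h3 : ((4 : ℝ) ^ t) ^ 2 = (2 ^ t) ^ 2 * 4 ^ t := by
      rw [← pow_mul, ← pow_mul, mul_comm t 2, pow_mul, pow_mul, ← mul_pow]; norm_num
    have h4 : (4 : ℝ) ^ t * ((q - M *ᵥ chebyshev (4 / 5) (4 / 3) M q t) ⬝ᵥ
        (q - M *ᵥ chebyshev (4 / 5) (4 / 3) M q t)) ≤ q ⬝ᵥ q := by
      have hp : (0 : ℝ) < (2 ^ t) ^ 2 := by positivity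
      refine le_of_mul_le_mul_left ?_ hp
      rw [← mul_assoc, ← h3]
      exact h.trans (mul_le_mul_of_nonneg_right h2 hq)
    have h5 : (1 / 4 : ℝ) ^ t ≤ (2 / 5) ^ t := pow_le_pow_left₀ (by norm_num) (by norm_num) t
    have h6 : (1 / 4 : ℝ) ^ t * 4 ^ t = 1 := by rw [← mul_pow]; norm_num
    have h7 : (0 : ℝ) ≤ (2 / 5) ^ t := by positivity
    calc _ = (1 / 4 : ℝ) ^ t * (4 ^ t * _) := by rw [← mul_assoc, h6, one_mul]
      _ ≤ (1 / 4 : ℝ) ^ t * (q ⬝ᵥ q) := by gcongr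
      _ ≤ 4 * (2 / 5) ^ t * (q ⬝ᵥ q) := by gcongr; linarith

end Solvers

/-! ### The spectral norm -/

section SpectralNorm

variable {a b : ℕ}

theorem norm_toLp_sq (v : Fin a → ℝ) : ‖WithLp.toLp 2 v‖ ^ 2 = v ⬝ᵥ v := by
  rw [EuclideanSpace.norm_sq_eq]
  simp [dotProduct, pow_two]

theorem specNorm_nonneg (Z : Matrix (Fin a) (Fin b) ℝ) : 0 ≤ specNorm Z := norm_nonneg _

theorem norm_mulVec_le (Z : Matrix (Fin a) (Fin b) ℝ) (v : Fin b → ℝ) :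
    ‖WithLp.toLp 2 (Z *ᵥ v)‖ ≤ specNorm Z * ‖WithLp.toLp 2 v‖ :=
  (LinearMap.toContinuousLinearMap (Matrix.toEuclideanLin Z)).le_opNorm (WithLp.toLp 2 v)

theorem specNorm_le {Z : Matrix (Fin a) (Fin b) ℝ} {c : ℝ} (hc : 0 ≤ c)
    (h : ∀ v, (Z *ᵥ v) ⬝ᵥ (Z *ᵥ v) ≤ c ^ 2 * (v ⬝ᵥ v)) : specNorm Z ≤ c := by
  refine ContinuousLinearMap.opNorm_le_bound _ hc fun v => ?_
  change ‖WithLp.toLp 2 (Z *ᵥ v.ofLp)‖ ≤ c * ‖WithLp.toLp 2 v.ofLp‖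
  refine le_of_sq_le_sq ?_ (by positivity)
  rw [mul_pow, norm_toLp_sq, norm_toLp_sq]
  exact h _

theorem abs_form_le (Z : Matrix (Fin a) (Fin a) ℝ) (u : Fin a → ℝ) :
    |u ⬝ᵥ Z *ᵥ u| ≤ specNorm Z * (u ⬝ᵥ u) := by
  have h1 := dotProduct_sq_le u (Z *ᵥ u)
  have h2 := norm_mulVec_le Z u
  rw [← norm_toLp_sq, ← norm_toLp_sq] at h1
  rw [← norm_toLp_sq]
  have h3 : |u ⬝ᵥ Z *ᵥ u| ≤ ‖WithLp.toLp 2 u‖ * ‖WithLp.toLp 2 (Z *ᵥ u)‖ := by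
    refine abs_le_of_sq_le_sq ?_ (by positivity)
    rw [mul_pow]; exact h1
  nlinarith [norm_nonneg (WithLp.toLp 2 u)]

end SpectralNorm

/-! ### Inverse square root of a Gram matrix -/

section Gram

variable {m n w : ℕ}

theorem gram_isHermitian (B : Matrix (Fin m) (Fin n) ℝ) : (B * Bᵀ).IsHermitian := by
  have := Matrix.isHermitian_mul_conjTranspose_self B
  rwa [Matrix.conjTranspose_eq_transpose_of_trivial] at this

theorem dotProduct_gram_mulVec (B : Matrix (Fin m) (Fin n) ℝ) (y : Fin m → ℝ) :
    y ⬝ᵥ (B * Bᵀ) *ᵥ y = (Bᵀ *ᵥ y) ⬝ᵥ (Bᵀ *ᵥ y) := by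
  rw [← Matrix.mulVec_mulVec, Matrix.dotProduct_mulVec, ← Matrix.mulVec_transpose]

theorem gram_posDef {B : Matrix (Fin m) (Fin n) ℝ}
    (h : ∀ y, y ≠ 0 → 0 < (Bᵀ *ᵥ y) ⬝ᵥ (Bᵀ *ᵥ y)) : (B * Bᵀ).PosDef :=
  .of_dotProduct_mulVec_pos (gram_isHermitian B) fun y hy => by
    rw [star_trivial, dotProduct_gram_mulVec]; exact h y hy

/-- Every function is continuous on a finite spectrum, so multiplicativity also covers functions
such as `(√x)⁻¹` that are discontinuous at `0`. -/
theorem cfc_mul_of_matrix {G : Matrix (Fin m) (Fin m) ℝ} (f g : ℝ → ℝ) :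
    cfc (fun x => f x * g x) G = cfc f G * cfc g G :=
  cfc_mul f g G (Matrix.finite_real_spectrum.continuousOn f)
    (Matrix.finite_real_spectrum.continuousOn g)

theorem pos_of_mem_spectrum {G : Matrix (Fin m) (Fin m) ℝ} (hG : G.PosDef) {x : ℝ}
    (hx : x ∈ spectrum ℝ G) : 0 < x := by
  rw [hG.1.spectrum_real_eq_range_eigenvalues] at hx
  obtain ⟨i, rfl⟩ := hx
  exact hG.eigenvalues_pos i

theorem invSqrtGram_isSymm (B : Matrix (Fin m) (Fin n) ℝ) : (invSqrtGram B).IsSymm := by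
  have : IsSelfAdjoint (invSqrtGram B) := cfc_predicate _ _
  rwa [isSelfAdjoint_iff, Matrix.star_eq_conjTranspose,
    Matrix.conjTranspose_eq_transpose_of_trivial] at this

theorem invSqrtGram_mul_gram_mul {B : Matrix (Fin m) (Fin n) ℝ} (hB : (B * Bᵀ).PosDef) :
    invSqrtGram B * (B * Bᵀ) * invSqrtGram B = 1 := by
  have hs : IsSelfAdjoint (B * Bᵀ) := gram_isHermitian B
  have h : invSqrtGram B * (B * Bᵀ) * invSqrtGram B =
      cfc (fun x : ℝ => (√x)⁻¹ * x * (√x)⁻¹) (B * Bᵀ) := by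
    rw [cfc_mul_of_matrix (fun x => (√x)⁻¹ * x), cfc_mul_of_matrix (fun x => (√x)⁻¹) (fun x => x),
      cfc_id' ℝ (B * Bᵀ) hs]
    rfl
  rw [h, ← cfc_const_one ℝ (B * Bᵀ) hs]
  refine cfc_congr fun x hx => ?_
  have hx0 := pos_of_mem_spectrum hB hx
  have : √x * √x = x := Real.mul_self_sqrt hx0.le
  have h0 : √x ≠ 0 := (Real.sqrt_pos.mpr hx0).ne'
  nth_rw 2 [← this]
  field_simp

theorem pinv_eq {B : Matrix (Fin m) (Fin n) ℝ} (hB : (B * Bᵀ).PosDef) :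
    pinv B = Bᵀ * (invSqrtGram B * invSqrtGram B) := by
  rw [pinv, invSqrtGram, ← cfc_mul_of_matrix]
  congr 1
  refine cfc_congr fun x hx => ?_
  have hx0 := pos_of_mem_spectrum hB hx
  rw [← mul_inv, Real.mul_self_sqrt hx0.le]

theorem gram_mul_invSqrtGram_sq {B : Matrix (Fin m) (Fin n) ℝ} (hB : (B * Bᵀ).PosDef) :
    (B * Bᵀ) * (invSqrtGram B * invSqrtGram B) = 1 := by
  have h := invSqrtGram_mul_gram_mul hB
  have h2 := mul_eq_one_comm.mp h
  have h3 : invSqrtGram B * ((B * Bᵀ) * invSqrtGram B) = 1 := by rw [← Matrix.mul_assoc, h]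
  have h4 := mul_eq_one_comm.mp h3
  rw [← Matrix.mul_assoc, h4]

theorem mul_pinv {B : Matrix (Fin m) (Fin n) ℝ} (hB : (B * Bᵀ).PosDef) : B * pinv B = 1 := by
  rw [pinv_eq hB, ← Matrix.mul_assoc, gram_mul_invSqrtGram_sq hB]

theorem invSqrtGram_sq_mul_gram {B : Matrix (Fin m) (Fin n) ℝ} (hB : (B * Bᵀ).PosDef) :
    (invSqrtGram B * invSqrtGram B) * (B * Bᵀ) = 1 :=
  mul_eq_one_comm.mp (gram_mul_invSqrtGram_sq hB)

theorem symm_mulVec_dotProduct {R : Matrix (Fin m) (Fin m) ℝ} (hR : R.IsSymm)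
    (u v : Fin m → ℝ) : (R *ᵥ u) ⬝ᵥ v = u ⬝ᵥ R *ᵥ v := by
  rw [dotProduct_comm, dotProduct_mulVec_symm hR]

theorem transpose_mulVec_dotProduct (B : Matrix (Fin m) (Fin n) ℝ) (u : Fin m → ℝ)
    (v : Fin n → ℝ) : (Bᵀ *ᵥ u) ⬝ᵥ v = u ⬝ᵥ B *ᵥ v := by
  rw [Matrix.dotProduct_mulVec, ← Matrix.mulVec_transpose]

theorem transpose_invSqrtGram_mulVec {B : Matrix (Fin m) (Fin n) ℝ} (hB : (B * Bᵀ).PosDef)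
    (u : Fin m → ℝ) :
    (Bᵀ *ᵥ (invSqrtGram B *ᵥ u)) ⬝ᵥ (Bᵀ *ᵥ (invSqrtGram B *ᵥ u)) = u ⬝ᵥ u := by
  rw [← dotProduct_gram_mulVec, symm_mulVec_dotProduct (invSqrtGram_isSymm B),
    Matrix.mulVec_mulVec, Matrix.mulVec_mulVec, invSqrtGram_mul_gram_mul hB, Matrix.one_mulVec]

end Gram

/-! ### Good sketches -/

section Sketch

variable {m n w : ℕ}

/-- The event in the definition of a sketching matrix, for accuracy `1/2`. -/
def GoodSketch {d : ℕ} (Z : Matrix (Fin d) (Fin n) ℝ) (r : ℕ) (W : Matrix (Fin n) (Fin w) ℝ) :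
    Prop :=
  specNorm (Z * W * Wᵀ * Zᵀ - Z * Zᵀ) ≤ 1 / 2 / 4 * (specNorm Z ^ 2 + frobSq Z / r)

theorem frobSq_eq_trace {d : ℕ} (Z : Matrix (Fin d) (Fin n) ℝ) : frobSq Z = (Z * Zᵀ).trace := by
  simp [frobSq, Matrix.trace, Matrix.mul_apply, pow_two]

theorem specNorm_sq_le_one_of_mul_transpose {d : ℕ} {Z : Matrix (Fin d) (Fin n) ℝ}
    (h : Z * Zᵀ = 1) : specNorm Z ^ 2 ≤ 1 := by
  have : specNorm Z ≤ 1 := by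
    refine specNorm_le zero_le_one fun v => ?_
    rw [one_pow, one_mul]
    have e : (Z *ᵥ v) ⬝ᵥ (Z *ᵥ v) = (Zᵀ *ᵥ (Z *ᵥ v)) ⬝ᵥ v := by
      rw [transpose_mulVec_dotProduct]
    have h1 := dotProduct_sq_le (Zᵀ *ᵥ (Z *ᵥ v)) v
    rw [← e, ← dotProduct_gram_mulVec, h, Matrix.one_mulVec] at h1
    rcases (dotProduct_self_nonneg' (Z *ᵥ v)).eq_or_lt with h0 | h0
    · rw [← h0]; exact dotProduct_self_nonneg' v
    · nlinarith
  nlinarith [specNorm_nonneg Z]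

/-- For orthonormal rows the spectral norm is at most `1` and the squared Frobenius norm is `d`. The
lemma serves twice: for the row space of `A D`, where `d = r = m`, and for the identity, where `d =
n`. -/
theorem GoodSketch.form_abs_le {d r : ℕ} {Z : Matrix (Fin d) (Fin n) ℝ} {W : Matrix (Fin n) (Fin w) ℝ}
    (hZ : Z * Zᵀ = 1) (h : GoodSketch Z r W) (u : Fin d → ℝ) :
    |(Wᵀ *ᵥ (Zᵀ *ᵥ u)) ⬝ᵥ (Wᵀ *ᵥ (Zᵀ *ᵥ u)) - u ⬝ᵥ u| ≤ (1 + d / r) / 8 * (u ⬝ᵥ u) := by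
  have h1 := abs_form_le (Z * W * Wᵀ * Zᵀ - Z * Zᵀ) u
  have h2 : u ⬝ᵥ (Z * W * Wᵀ * Zᵀ - Z * Zᵀ) *ᵥ u =
      (Wᵀ *ᵥ (Zᵀ *ᵥ u)) ⬝ᵥ (Wᵀ *ᵥ (Zᵀ *ᵥ u)) - u ⬝ᵥ u := by
    have e : Z * W * Wᵀ * Zᵀ = (Z * W) * (Z * W)ᵀ := by
      rw [Matrix.transpose_mul, Matrix.mul_assoc (Z * W) Wᵀ]
    rw [Matrix.sub_mulVec, dotProduct_sub, hZ, Matrix.one_mulVec, e, dotProduct_gram_mulVec,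
      Matrix.transpose_mul, Matrix.mulVec_mulVec]
  rw [h2] at h1
  refine h1.trans (mul_le_mul_of_nonneg_right ?_ (dotProduct_self_nonneg' u))
  refine le_trans h ?_
  rw [frobSq_eq_trace, hZ, Matrix.trace_one, Fintype.card_fin]
  have := specNorm_sq_le_one_of_mul_transpose hZ
  have h3 : (0 : ℝ) ≤ d / r := by positivity
  linarith

/-- The row-orthonormal matrix `(B Bᵀ)^{-1/2} B` with the same row space as `B`. -/
noncomputable def orthonormalRows (B : Matrix (Fin m) (Fin n) ℝ) : Matrix (Fin m) (Fin n) ℝ :=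
  invSqrtGram B * B

theorem orthonormalRows_mul_transpose {B : Matrix (Fin m) (Fin n) ℝ} (hB : (B * Bᵀ).PosDef) :
    orthonormalRows B * (orthonormalRows B)ᵀ = 1 := by
  rw [orthonormalRows, Matrix.transpose_mul, (invSqrtGram_isSymm B).eq,
    ← invSqrtGram_mul_gram_mul hB]
  simp only [Matrix.mul_assoc]

/-- A good sketch of the row space of `B` preserves the form `y ↦ ‖Bᵀ y‖²` up to a factor in
`[3/4, 5/4]`. -/
theorem GoodSketch.gram_bounds {B : Matrix (Fin m) (Fin n) ℝ} {W : Matrix (Fin n) (Fin w) ℝ}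
    (hB : (B * Bᵀ).PosDef) (h : GoodSketch (orthonormalRows B) m W) (y : Fin m → ℝ) :
    |((B * W)ᵀ *ᵥ y) ⬝ᵥ ((B * W)ᵀ *ᵥ y) - (Bᵀ *ᵥ y) ⬝ᵥ (Bᵀ *ᵥ y)| ≤
      1 / 4 * ((Bᵀ *ᵥ y) ⬝ᵥ (Bᵀ *ᵥ y)) := by
  obtain ⟨z, hz⟩ : ∃ z, invSqrtGram B *ᵥ z = y :=
    ⟨invSqrtGram B *ᵥ ((B * Bᵀ) *ᵥ y), by
      rw [Matrix.mulVec_mulVec, Matrix.mulVec_mulVec, invSqrtGram_sq_mul_gram hB,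
        Matrix.one_mulVec]⟩
  have h1 := h.form_abs_le (orthonormalRows_mul_transpose hB) z
  have e1 : (orthonormalRows B)ᵀ *ᵥ z = Bᵀ *ᵥ y := by
    rw [orthonormalRows, Matrix.transpose_mul, (invSqrtGram_isSymm B).eq, ← Matrix.mulVec_mulVec,
      hz]
  have e2 : z ⬝ᵥ z = (Bᵀ *ᵥ y) ⬝ᵥ (Bᵀ *ᵥ y) := by
    rw [← transpose_invSqrtGram_mulVec hB, hz]
  rw [e1, e2, Matrix.mulVec_mulVec, ← Matrix.transpose_mul] at h1
  refine h1.trans (mul_le_mul_of_nonneg_right ?_ (dotProduct_self_nonneg' _))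
  -- Only an inequality, because `0 / 0 = 0` when `m = 0`.
  have : (m : ℝ) / m ≤ 1 := div_self_le_one _
  linarith

/-- A bound on `‖W‖²` extracted from the sketching property at `Z = 1`: it controls `‖Wᵀ u‖²` for `u
= W v`, and `‖u‖² = Wᵀ u ⬝ᵥ v`. The loss of a factor `n` is harmless, since it costs only `O(log n)`
inner iterations. -/
theorem GoodSketch.mulVec_sq_le {r : ℕ} {W : Matrix (Fin n) (Fin w) ℝ}
    (h : GoodSketch (1 : Matrix (Fin n) (Fin n) ℝ) r W) (v : Fin w → ℝ) :
    (W *ᵥ v) ⬝ᵥ (W *ᵥ v) ≤ (2 + n) * (v ⬝ᵥ v) := by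
  have h1 := h.form_abs_le (by simp) (W *ᵥ v)
  rw [Matrix.transpose_one, Matrix.one_mulVec] at h1
  have h2 := (abs_le.mp h1).2
  have h3 : (n : ℝ) / r ≤ n := by
    rcases Nat.eq_zero_or_pos r with rfl | hr
    · simp
    · exact div_le_self (by positivity) (by exact_mod_cast hr)
  have h0 := dotProduct_self_nonneg' (W *ᵥ v)
  have h4 := dotProduct_sq_le (Wᵀ *ᵥ (W *ᵥ v)) v
  rw [transpose_mulVec_dotProduct] at h4
  have h5 : (Wᵀ *ᵥ (W *ᵥ v)) ⬝ᵥ (Wᵀ *ᵥ (W *ᵥ v)) ≤ (2 + n) * ((W *ᵥ v) ⬝ᵥ (W *ᵥ v)) := by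
    have hn : (0 : ℝ) ≤ n := by positivity
    nlinarith [mul_nonneg hn h0, mul_le_mul_of_nonneg_right h3 h0]
  rcases h0.eq_or_lt with h0 | h0
  · rw [← h0]; exact mul_nonneg (by positivity) (dotProduct_self_nonneg' v)
  · refine le_of_mul_le_mul_left ?_ h0
    nlinarith [mul_le_mul_of_nonneg_right h5 (dotProduct_self_nonneg' v)]

theorem GoodSketch.sketched_posDef {B : Matrix (Fin m) (Fin n) ℝ} {W : Matrix (Fin n) (Fin w) ℝ}
    (hB : (B * Bᵀ).PosDef) (h : GoodSketch (orthonormalRows B) m W) :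
    ((B * W) * (B * W)ᵀ).PosDef := by
  refine gram_posDef fun y hy => ?_
  have h1 := hB.dotProduct_mulVec_pos hy
  rw [star_trivial, dotProduct_gram_mulVec] at h1
  have h2 := abs_le.mp (h.gram_bounds hB y)
  linarith

/-! ### The preconditioned system and the size of the correction -/

section Preconditioned

variable {B : Matrix (Fin m) (Fin n) ℝ} {W : Matrix (Fin n) (Fin w) ℝ}

theorem preconditioned_form (u : Fin m → ℝ) :
    u ⬝ᵥ (invSqrtGram (B * W) * (B * Bᵀ) * invSqrtGram (B * W)) *ᵥ u =
      (Bᵀ *ᵥ (invSqrtGram (B * W) *ᵥ u)) ⬝ᵥ (Bᵀ *ᵥ (invSqrtGram (B * W) *ᵥ u)) := by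
  rw [← dotProduct_gram_mulVec, symm_mulVec_dotProduct (invSqrtGram_isSymm (B * W)),
    Matrix.mulVec_mulVec, Matrix.mulVec_mulVec, ← Matrix.mul_assoc]

/-- For `y = Q^{-1/2} u`, with `Q` the Gram matrix of `B W`, one has `‖u‖² = ‖(B W)ᵀ y‖²`, which
lies between `3/4` and `5/4` times `‖Bᵀ y‖²`. Inverting gives `4/5` and `4/3`, the ends of the
Chebyshev interval for `ζ = 1/2`. -/
theorem GoodSketch.preconditioned_bounds (hB : (B * Bᵀ).PosDef)
    (h : GoodSketch (orthonormalRows B) m W) (u : Fin m → ℝ) :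
    4 / 5 * (u ⬝ᵥ u) ≤
        u ⬝ᵥ (invSqrtGram (B * W) * (B * Bᵀ) * invSqrtGram (B * W)) *ᵥ u ∧
      u ⬝ᵥ (invSqrtGram (B * W) * (B * Bᵀ) * invSqrtGram (B * W)) *ᵥ u ≤ 4 / 3 * (u ⬝ᵥ u) := by
  have h2 := abs_le.mp (h.gram_bounds hB (invSqrtGram (B * W) *ᵥ u))
  rw [transpose_invSqrtGram_mulVec (h.sketched_posDef hB)] at h2
  rw [preconditioned_form]
  constructor <;> linarith

/-- The correction `W (BW)^† (B Bᵀ y - B g)` restores feasibility and is exponentially small in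
the number of inner iterations. -/
theorem GoodSketch.correction_bound (hB : (B * Bᵀ).PosDef) {r : ℕ}
    (h : GoodSketch (orthonormalRows B) m W)
    (h' : GoodSketch (1 : Matrix (Fin n) (Fin n) ℝ) r W) (alg : Solver) (t : ℕ) (g : Fin n → ℝ)
    {f : Fin m → ℝ} {u : Fin n → ℝ}
    (hf : f = (B * Bᵀ) *ᵥ (invSqrtGram (B * W) *ᵥ alg.solve (1 / 2)
      (invSqrtGram (B * W) * (B * Bᵀ) * invSqrtGram (B * W))
      (invSqrtGram (B * W) *ᵥ (B *ᵥ g)) t) - B *ᵥ g)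
    (hu : u = W *ᵥ (pinv (B * W) *ᵥ f)) :
    B *ᵥ u = f ∧ u ⬝ᵥ u ≤ (2 + n) * (16 / 3 * (2 / 5) ^ t * (g ⬝ᵥ g)) := by
  have hQ := h.sketched_posDef hB
  set R := invSqrtGram (B * W) with hR
  have hRs : R.IsSymm := invSqrtGram_isSymm _
  set M := R * (B * Bᵀ) * R with hM
  have hMs : M.IsSymm := by
    rw [hM, Matrix.IsSymm, Matrix.transpose_mul, Matrix.transpose_mul, Matrix.transpose_mul,
      Matrix.transpose_transpose, hRs.eq]
    simp only [Matrix.mul_assoc]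
  constructor
  · rw [hu, Matrix.mulVec_mulVec, Matrix.mulVec_mulVec, mul_pinv hQ, Matrix.one_mulVec]
  -- Up to sign, `R f` is the residual of the inner solver.
  · have hRf : R *ᵥ f = -(R *ᵥ (B *ᵥ g) - M *ᵥ alg.solve (1 / 2) M (R *ᵥ (B *ᵥ g)) t) := by
      rw [hf, Matrix.mulVec_sub, neg_sub]
      simp only [Matrix.mulVec_mulVec, hM, Matrix.mul_assoc]
    have h1 := alg.residual_le hMs (fun u => (h.preconditioned_bounds hB u).1)
      (fun u => (h.preconditioned_bounds hB u).2) (R *ᵥ (B *ᵥ g)) t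
    -- `M = (R B)(R B)ᵀ` has form at most `4/3`, so `R B` has squared norm at most `4/3`.
    have hq : (R *ᵥ (B *ᵥ g)) ⬝ᵥ (R *ᵥ (B *ᵥ g)) ≤ 4 / 3 * (g ⬝ᵥ g) := by
      set v := R *ᵥ (B *ᵥ g) with hv
      have e : v ⬝ᵥ v = (Bᵀ *ᵥ (R *ᵥ v)) ⬝ᵥ g := by
        rw [transpose_mulVec_dotProduct, symm_mulVec_dotProduct hRs v]
      have h2 := (h.preconditioned_bounds hB v).2
      rw [preconditioned_form] at h2
      have h3 := dotProduct_sq_le (Bᵀ *ᵥ (R *ᵥ v)) g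
      rw [← e] at h3
      have hg := dotProduct_self_nonneg' g
      rcases (dotProduct_self_nonneg' v).eq_or_lt with h0 | h0
      · rw [← h0]; positivity
      · refine le_of_mul_le_mul_left ?_ h0
        nlinarith [mul_le_mul_of_nonneg_right h2 hg]
    -- `pinv (B * W)` is `((B W)ᵀ R) R`, and `(B W)ᵀ R` is an isometry.
    have e : (pinv (B * W) *ᵥ f) ⬝ᵥ (pinv (B * W) *ᵥ f) = (R *ᵥ f) ⬝ᵥ (R *ᵥ f) := by
      rw [pinv_eq hQ, ← transpose_invSqrtGram_mulVec hQ (R *ᵥ f)]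
      simp only [Matrix.mulVec_mulVec, hR]
    have h2 := h'.mulVec_sq_le (pinv (B * W) *ᵥ f)
    rw [← hu, e, hRf, neg_dotProduct_neg] at h2
    refine h2.trans ?_
    gcongr
    refine h1.trans ?_
    calc _ ≤ 4 * (2 / 5) ^ t * (4 / 3 * (g ⬝ᵥ g)) := by gcongr
      _ = _ := by ring

end Preconditioned

end Sketch

/-! ### Analysis of one outer step -/

section Step

variable {m n w : ℕ}

/-- A feasible direction that solves the linearised complementarity equations up to `v`. -/
structure IsNewtonDirection (A : Matrix (Fin m) (Fin n) ℝ) (σ : ℝ) (p dir : Triplet m n)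
    (v : Fin n → ℝ) : Prop where
  primal : A *ᵥ dir.1 = 0
  dual : Aᵀ *ᵥ dir.2.1 + dir.2.2 = 0
  complementarity : ∀ i, p.2.2 i * dir.1 i + p.1 i * dir.2.2 i =
    -(p.1 i * p.2.2 i) + σ * dualityMeasure p - v i

/-- `Δx` lies in the kernel of `A` and `Δs` in the range of `Aᵀ`. -/
theorem IsNewtonDirection.orthogonal {A : Matrix (Fin m) (Fin n) ℝ} {σ : ℝ} {p dir : Triplet m n}
    {v : Fin n → ℝ} (h : IsNewtonDirection A σ p dir v) : dir.1 ⬝ᵥ dir.2.2 = 0 := by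
  rw [eq_neg_of_add_eq_zero_right h.dual, dotProduct_neg, dotProduct_comm,
    transpose_mulVec_dotProduct, h.primal, dotProduct_zero, neg_zero]

theorem dualityMeasure_nonneg {A : Matrix (Fin m) (Fin n) ℝ} {b : Fin m → ℝ} {c : Fin n → ℝ}
    {p : Triplet m n} (hp : p ∈ strictlyFeasible A b c) : 0 ≤ dualityMeasure p :=
  div_nonneg (Finset.sum_nonneg fun i _ => (mul_pos (hp.1 i) (hp.2.1 i)).le) (Nat.cast_nonneg n)

theorem dualityMeasure_pos [NeZero n] {A : Matrix (Fin m) (Fin n) ℝ} {b : Fin m → ℝ}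
    {c : Fin n → ℝ} {p : Triplet m n} (hp : p ∈ strictlyFeasible A b c) :
    0 < dualityMeasure p :=
  div_pos (Finset.sum_pos (fun i _ => mul_pos (hp.1 i) (hp.2.1 i)) Finset.univ_nonempty)
    (Nat.cast_pos.mpr (NeZero.pos n))

theorem dotProduct_eq_mul_dualityMeasure [NeZero n] (p : Triplet m n) :
    p.1 ⬝ᵥ p.2.2 = n * dualityMeasure p := by
  have : (n : ℝ) ≠ 0 := Nat.cast_ne_zero.mpr (NeZero.ne n)
  rw [dualityMeasure]; field_simp

/-- Orthogonality kills the quadratic term, so `μ` is affine in the step length and `v` enters only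
through its mean. -/
theorem IsNewtonDirection.dualityMeasure_add_smul [NeZero n] {A : Matrix (Fin m) (Fin n) ℝ} {σ : ℝ}
    {p dir : Triplet m n} {v : Fin n → ℝ} (h : IsNewtonDirection A σ p dir v) (α : ℝ) :
    dualityMeasure (p + α • dir) =
      dualityMeasure p * (1 - α * (1 - σ)) - α * ((∑ i, v i) / n) := by
  have hn : (n : ℝ) ≠ 0 := Nat.cast_ne_zero.mpr (NeZero.ne n)
  have h1 : p.2.2 ⬝ᵥ dir.1 + p.1 ⬝ᵥ dir.2.2 =
      -(n * dualityMeasure p) + n * (σ * dualityMeasure p) - ∑ i, v i := by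
    rw [← dotProduct_eq_mul_dualityMeasure]
    simp only [dotProduct]
    rw [← Finset.sum_add_distrib, Finset.sum_congr rfl fun i _ => h.complementarity i,
      Finset.sum_sub_distrib, Finset.sum_add_distrib, Finset.sum_neg_distrib]
    simp
  have h2 : (p + α • dir).1 ⬝ᵥ (p + α • dir).2.2 =
      p.1 ⬝ᵥ p.2.2 + α * (p.2.2 ⬝ᵥ dir.1 + p.1 ⬝ᵥ dir.2.2) + α ^ 2 * (dir.1 ⬝ᵥ dir.2.2) := by
    simp only [Prod.fst_add, Prod.snd_add, Prod.smul_fst, Prod.smul_snd, add_dotProduct,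
      dotProduct_add, smul_dotProduct, dotProduct_smul, smul_eq_mul, dotProduct_comm p.2.2 dir.1]
    ring
  rw [h.orthogonal, h1, dotProduct_eq_mul_dualityMeasure p] at h2
  rw [dualityMeasure, h2]
  field_simp
  ring

/-- In scaled variables `a = √(s/x) Δx` and `a' = √(x/s) Δs`, orthogonality gives `∑ (a + a')² =
‖a‖² + ‖a'‖²`, which dominates `2 |Δx_i Δs_i|` for each single `i`. The complementarity equations
bound the sum by `9nμ/(1-γ)`; half of it is below the stated bound. -/
theorem IsNewtonDirection.abs_mul_le [NeZero n] {A : Matrix (Fin m) (Fin n) ℝ} {b : Fin m → ℝ}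
    {c : Fin n → ℝ} {γ σ : ℝ} (hγ0 : 0 < γ) (hγ1 : γ < 1) (hσ0 : 0 < σ) (hσ1 : σ < 1)
    {p dir : Triplet m n} {v : Fin n → ℝ} (h : IsNewtonDirection A σ p dir v)
    (hp : p ∈ neighborhood A b c γ) (hv : ∀ i, |v i| ≤ γ * σ / 4 * dualityMeasure p) (i : Fin n) :
    |dir.1 i * dir.2.2 i| ≤ 5 / (1 - γ) * n * dualityMeasure p := by
  have hx := hp.1.1
  have hs := hp.1.2.1
  have hμ := dualityMeasure_pos hp.1
  have hγ : 0 < 1 - γ := by linarith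
  set μ := dualityMeasure p with hμdef
  have hγσ : γ * σ ≤ 1 := by nlinarith
  let q : Fin n → ℝ := fun j =>
    (p.2.2 j * dir.1 j + p.1 j * dir.2.2 j) ^ 2 / (p.1 j * p.2.2 j)
  have hq : ∀ j, q j = p.2.2 j / p.1 j * dir.1 j ^ 2 + p.1 j / p.2.2 j * dir.2.2 j ^ 2
      + 2 * (dir.1 j * dir.2.2 j) := fun j => by
    have := (hx j).ne'
    have := (hs j).ne'
    simp only [q]
    field_simp
    ring
  have hsum : ∑ j, q j =
      ∑ j, (p.2.2 j / p.1 j * dir.1 j ^ 2 + p.1 j / p.2.2 j * dir.2.2 j ^ 2) := by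
    have h0 : ∑ j, dir.1 j * dir.2.2 j = 0 := h.orthogonal
    rw [Finset.sum_congr rfl fun j _ => hq j, Finset.sum_add_distrib, ← Finset.mul_sum, h0,
      mul_zero, add_zero]
  have hnn : ∀ j,
      0 ≤ p.2.2 j / p.1 j * dir.1 j ^ 2 + p.1 j / p.2.2 j * dir.2.2 j ^ 2 := fun j => by
    have := hx j
    have := hs j
    positivity
  have hle : 2 * |dir.1 i * dir.2.2 i| ≤ ∑ j, q j := by
    rw [hsum]
    refine le_trans ?_ (Finset.single_le_sum (fun j _ => hnn j) (Finset.mem_univ i))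
    have hxi := hx i
    have hsi := hs i
    set a := √(p.2.2 i / p.1 i) with ha
    set a' := √(p.1 i / p.2.2 i) with ha'
    have haa : a * a' = 1 := by
      rw [ha, ha', ← Real.sqrt_mul (by positivity)]
      rw [show p.2.2 i / p.1 i * (p.1 i / p.2.2 i) = 1 by field_simp, Real.sqrt_one]
    have h1 : a ^ 2 = p.2.2 i / p.1 i := Real.sq_sqrt (by positivity)
    have h2 : a' ^ 2 = p.1 i / p.2.2 i := Real.sq_sqrt (by positivity)
    rw [← h1, ← h2]
    have e : dir.1 i * dir.2.2 i = (a * dir.1 i) * (a' * dir.2.2 i) := by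
      linear_combination (-(dir.1 i * dir.2.2 i)) * haa
    rw [e, abs_mul]
    nlinarith [sq_nonneg (|a * dir.1 i| - |a' * dir.2.2 i|), sq_abs (a * dir.1 i),
      sq_abs (a' * dir.2.2 i)]
  have hbd : ∀ j, q j ≤ 3 * (p.1 j * p.2.2 j) + 6 / (1 - γ) * μ := fun j => by
    have hP : 0 < p.1 j * p.2.2 j := mul_pos (hx j) (hs j)
    have hPl := hp.2 j
    rw [← hμdef] at hPl
    simp only [q]
    rw [h.complementarity j, ← hμdef]
    set P := p.1 j * p.2.2 j
    have h1 : (-P + σ * μ - v j) ^ 2 ≤ 3 * P ^ 2 + 3 * (σ * μ) ^ 2 + 3 * (v j) ^ 2 := by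
      nlinarith [sq_nonneg (-P - σ * μ), sq_nonneg (-P + v j), sq_nonneg (σ * μ + v j)]
    have h2 : (v j) ^ 2 ≤ μ ^ 2 := by
      rw [← sq_abs]
      have : |v j| ≤ μ := (hv j).trans (by nlinarith)
      gcongr
    have h3 : (σ * μ) ^ 2 ≤ μ ^ 2 := by
      have : σ * μ ≤ μ := by nlinarith
      gcongr
    rw [div_le_iff₀ hP]
    have h4 : μ ^ 2 ≤ μ / (1 - γ) * P := by
      rw [div_mul_eq_mul_div, le_div_iff₀ hγ]; nlinarith
    have h5 : 6 / (1 - γ) * μ * P = 6 * (μ / (1 - γ) * P) := by ring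
    nlinarith
  have htot : ∑ j, q j ≤ 9 / (1 - γ) * n * μ := by
    calc ∑ j, q j ≤ ∑ j, (3 * (p.1 j * p.2.2 j) + 6 / (1 - γ) * μ) :=
          Finset.sum_le_sum fun j _ => hbd j
      _ = 3 * (n * μ) + n * (6 / (1 - γ) * μ) := by
          rw [Finset.sum_add_distrib, ← Finset.mul_sum, hμdef, ← dotProduct_eq_mul_dualityMeasure]
          simp [dotProduct]
      _ ≤ 9 / (1 - γ) * n * μ := by
          have h1 : 1 ≤ 1 / (1 - γ) := by rw [le_div_iff₀ hγ]; linarith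
          have h2 : (0 : ℝ) ≤ n * μ := by positivity
          have h3 := mul_le_mul_of_nonneg_right h1 h2
          have e1 : 9 / (1 - γ) * n * μ = 9 * (1 / (1 - γ) * (n * μ)) := by ring
          have e2 : n * (6 / (1 - γ) * μ) = 6 * (1 / (1 - γ) * (n * μ)) := by ring
          rw [e1, e2]
          linarith
  have : 5 / (1 - γ) * n * μ = 10 / 9 * (9 / (1 - γ) * n * μ) / 2 := by ring
  have h9 : 0 ≤ 9 / (1 - γ) * n * μ := by positivity
  linarith

theorem mem_neighborhood_add_smul_iff {A : Matrix (Fin m) (Fin n) ℝ} {b : Fin m → ℝ}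
    {c : Fin n → ℝ} {γ σ : ℝ} {p dir : Triplet m n} {v : Fin n → ℝ}
    (h : IsNewtonDirection A σ p dir v)
    (hp : p ∈ neighborhood A b c γ) {α : ℝ} :
    p + α • dir ∈ neighborhood A b c γ ↔
      (∀ i, 0 < p.1 i + α * dir.1 i) ∧ (∀ i, 0 < p.2.2 i + α * dir.2.2 i) ∧
      ∀ i, (1 - γ) * dualityMeasure (p + α • dir) ≤
        (p.1 i + α * dir.1 i) * (p.2.2 i + α * dir.2.2 i) := by
  have h1 : A *ᵥ (p + α • dir).1 = b := by
    rw [Prod.fst_add, Prod.smul_fst, Matrix.mulVec_add, Matrix.mulVec_smul, h.primal, smul_zero,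
      add_zero, hp.1.2.2.1]
  have h2 : Aᵀ *ᵥ (p + α • dir).2.1 + (p + α • dir).2.2 = c := by
    rw [Prod.snd_add, Prod.fst_add, Prod.snd_add, Prod.smul_snd, Prod.smul_fst, Prod.smul_snd,
      Matrix.mulVec_add, Matrix.mulVec_smul, add_add_add_comm, ← smul_add, h.dual, smul_zero,
      add_zero, hp.1.2.2.2]
  constructor
  · rintro ⟨⟨h3, h4, -⟩, h5⟩
    exact ⟨h3, h4, h5⟩
  · rintro ⟨h3, h4, h5⟩
    exact ⟨⟨h3, h4, h1, h2⟩, h5⟩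

/-- The relative decrease of the duality measure in one step is at least this constant over `n`. -/
noncomputable def decreaseRate (γ σ : ℝ) : ℝ := γ * σ * (1 - γ) / 10 * (1 - σ - γ * σ / 4)

/-! ### Step lengths and the decrease of the duality measure -/

section Update

variable [NeZero n] {A : Matrix (Fin m) (Fin n) ℝ} {b : Fin m → ℝ} {c : Fin n → ℝ} {γ σ : ℝ}
  {p dir : Triplet m n} {v : Fin n → ℝ}

theorem abs_sum_div_le {c : ℝ} (hv : ∀ i, |v i| ≤ c) : |(∑ i, v i) / n| ≤ c := by
  have hn : (0 : ℝ) < n := Nat.cast_pos.mpr (NeZero.pos n)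
  rw [abs_div, abs_of_pos hn, div_le_iff₀ hn]
  calc |∑ i, v i| ≤ ∑ i, |v i| := Finset.abs_sum_le_sum_abs _ _
    _ ≤ ∑ _i : Fin n, c := Finset.sum_le_sum fun i _ => hv i
    _ = c * n := by simp [mul_comm]

/-- Even at `α = 1` a fraction `σ - γσ/4 > 0` of `μ` remains. With this, the weak inequalities `x_i
s_i ≥ (1-γ)μ` force the products to be strictly positive. -/
theorem IsNewtonDirection.dualityMeasure_add_smul_pos (hγ1 : γ < 1) (hσ0 : 0 < σ)
    (h : IsNewtonDirection A σ p dir v) (hp : p ∈ neighborhood A b c γ)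
    (hv : ∀ i, |v i| ≤ γ * σ / 4 * dualityMeasure p) {α : ℝ} (hα : α ∈ Set.Icc (0 : ℝ) 1) :
    0 < dualityMeasure (p + α • dir) := by
  rw [h.dualityMeasure_add_smul]
  have hμ := dualityMeasure_pos hp.1
  have h1 := (abs_le.mp (abs_sum_div_le hv)).2
  have h2 := mul_le_mul_of_nonneg_left h1 hα.1
  have h3 : 0 < 1 - α * (1 - σ) - α * (γ * σ / 4) := by
    have h4 : γ * σ < σ := by nlinarith
    have : 0 ≤ α * (σ - γ * σ / 4) := mul_nonneg hα.1 (by linarith)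
    rcases hα.2.lt_or_eq with h5 | h5
    · linarith
    · subst h5; linarith
  nlinarith [mul_pos hμ h3]

theorem IsNewtonDirection.dualityMeasure_add_smul_le
    (h : IsNewtonDirection A σ p dir v)
    (hv : ∀ i, |v i| ≤ γ * σ / 4 * dualityMeasure p) {α : ℝ} (hα : 0 ≤ α) :
    dualityMeasure (p + α • dir) ≤ (1 - α * (1 - σ - γ * σ / 4)) * dualityMeasure p := by
  rw [h.dualityMeasure_add_smul]
  have h1 := (abs_le.mp (abs_sum_div_le hv)).1
  nlinarith [mul_le_mul_of_nonneg_left h1 hα]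

/-- If a product of two affine functions is positive on `[0, a]` and the factors are positive at
`0`, then they are positive at `a`. -/
theorem affine_pos_of_mul_pos {x dx s ds a : ℝ} (ha : 0 ≤ a) (hx : 0 < x)
    (h : ∀ α ∈ Set.Icc 0 a, 0 < (x + α * dx) * (s + α * ds)) : 0 < x + a * dx := by
  by_contra! hneg
  have hdx : dx < 0 := by nlinarith
  have h1 : -x / dx ∈ Set.Icc 0 a := by
    constructor
    · exact div_nonneg_of_nonpos (by linarith) hdx.le
    · rw [div_le_iff_of_neg hdx]; linarith
  have h2 := h _ h1
  rw [div_mul_cancel₀ _ hdx.ne, add_neg_cancel, zero_mul] at h2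
  exact h2.false

/-- Compared with `(1-γ)μ(α)`, the product `x_i s_i` at `α` gains `αγσμ` from centring. Against this
stand `v i` and the mean of `v`, each costing at most `αγσμ/4`, and the second-order term `α² Δx_i
Δs_i`, which costs at most `αγσμ/2` for these `α`. Positivity of the separate factors follows by
continuation from `α = 0`. -/
theorem IsNewtonDirection.mem_neighborhood (hγ0 : 0 < γ) (hγ1 : γ < 1) (hσ0 : 0 < σ)
    (hσ1 : σ < 1) (h : IsNewtonDirection A σ p dir v) (hp : p ∈ neighborhood A b c γ)
    (hv : ∀ i, |v i| ≤ γ * σ / 4 * dualityMeasure p) {α : ℝ}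
    (hα : α ∈ Set.Icc (0 : ℝ) (γ * σ * (1 - γ) / 10 / n)) :
    p + α • dir ∈ neighborhood A b c γ := by
  have hn : (1 : ℝ) ≤ n := by exact_mod_cast NeZero.pos n
  have hμ := dualityMeasure_pos hp.1
  have hγ : 0 < 1 - γ := by linarith
  have hγσ : γ * σ < 1 := by nlinarith
  have hle1 : γ * σ * (1 - γ) / 10 / n ≤ 1 := by
    rw [div_le_one (by linarith)]
    nlinarith
  have hprod : ∀ α ∈ Set.Icc (0 : ℝ) (γ * σ * (1 - γ) / 10 / n), ∀ i,
      (1 - γ) * dualityMeasure (p + α • dir) ≤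
        (p.1 i + α * dir.1 i) * (p.2.2 i + α * dir.2.2 i) := by
    intro α hα i
    have hα1 : α ≤ 1 := hα.2.trans hle1
    have h1 := (abs_le.mp (h.abs_mul_le hγ0 hγ1 hσ0 hσ1 hp hv i)).1
    have h2 := abs_le.mp (abs_sum_div_le hv)
    have h3 := abs_le.mp (hv i)
    have h4 := hp.2 i
    have h5 := h.complementarity i
    rw [h.dualityMeasure_add_smul]
    set μ := dualityMeasure p
    set V := (∑ i, v i) / (n : ℝ)
    have hαn : α * (5 / (1 - γ) * n * μ) ≤ γ * σ / 2 * μ := by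
      have : α * n ≤ γ * σ * (1 - γ) / 10 := by
        have := hα.2; rwa [le_div_iff₀ (by linarith)] at this
      calc α * (5 / (1 - γ) * n * μ) = (α * n) * (5 / (1 - γ) * μ) := by ring
        _ ≤ γ * σ * (1 - γ) / 10 * (5 / (1 - γ) * μ) := by gcongr
        _ = _ := by field_simp; ring
    have e : (p.1 i + α * dir.1 i) * (p.2.2 i + α * dir.2.2 i) =
        (1 - α) * (p.1 i * p.2.2 i) + α * (σ * μ - v i) + α * (α * (dir.1 i * dir.2.2 i)) := by
      linear_combination α * h5
    rw [e]
    have h6 : α * (-(γ * σ / 2 * μ)) ≤ α * (α * (dir.1 i * dir.2.2 i)) := by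
      refine mul_le_mul_of_nonneg_left ?_ hα.1
      nlinarith [mul_le_mul_of_nonneg_left h1 hα.1]
    have h7 : (1 - α) * ((1 - γ) * μ) ≤ (1 - α) * (p.1 i * p.2.2 i) :=
      mul_le_mul_of_nonneg_left h4 (by linarith)
    have h8 : α * v i ≤ α * (γ * σ / 4 * μ) := mul_le_mul_of_nonneg_left h3.2 hα.1
    have h9 : (α * (1 - γ)) * (-V) ≤ α * (γ * σ / 4 * μ) := by
      have h10 : (α * (1 - γ)) * (-V) ≤ (α * (1 - γ)) * (γ * σ / 4 * μ) :=
        mul_le_mul_of_nonneg_left (by linarith) (mul_nonneg hα.1 hγ.le)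
      have h11 : 0 ≤ α * γ * (γ * σ / 4 * μ) :=
        mul_nonneg (mul_nonneg hα.1 hγ0.le) (by positivity)
      linarith
    nlinarith
  have hpos : ∀ i, ∀ β ∈ Set.Icc (0 : ℝ) α,
      0 < (p.1 i + β * dir.1 i) * (p.2.2 i + β * dir.2.2 i) := by
    intro i β hβ
    have hβ' : β ∈ Set.Icc (0 : ℝ) (γ * σ * (1 - γ) / 10 / n) := ⟨hβ.1, hβ.2.trans hα.2⟩
    exact lt_of_lt_of_le (mul_pos hγ (h.dualityMeasure_add_smul_pos hγ1 hσ0 hp hv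
      ⟨hβ.1, hβ'.2.trans hle1⟩)) (hprod β hβ' i)
  rw [mem_neighborhood_add_smul_iff h hp]
  refine ⟨fun i => affine_pos_of_mul_pos hα.1 (hp.1.1 i) (hpos i), fun i => ?_, hprod α hα⟩
  refine affine_pos_of_mul_pos (s := p.1 i) (ds := dir.1 i) hα.1 (hp.1.2.1 i) fun β hβ => ?_
  rw [mul_comm]
  exact hpos i β hβ

/-- The supremum is attained: although the neighbourhood is cut out by strict inequalities,
positivity of `μ` on `[0, 1]` allows weak ones, which describe a compact set of step lengths. -/
theorem IsNewtonDirection.maxStep_mem (hγ1 : γ < 1) (hσ0 : 0 < σ)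
    (h : IsNewtonDirection A σ p dir v) (hp : p ∈ neighborhood A b c γ)
    (hv : ∀ i, |v i| ≤ γ * σ / 4 * dualityMeasure p) :
    maxStep A b c γ p dir ∈
      {α : ℝ | α ∈ Set.Icc 0 1 ∧ p + α • dir ∈ neighborhood A b c γ} := by
  have hγ : 0 < 1 - γ := by linarith
  have hset : {α : ℝ | α ∈ Set.Icc 0 1 ∧ p + α • dir ∈ neighborhood A b c γ} =
      Set.Icc 0 1 ∩ {α : ℝ | (∀ i, 0 ≤ p.1 i + α * dir.1 i) ∧
        (∀ i, 0 ≤ p.2.2 i + α * dir.2.2 i) ∧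
        ∀ i, (1 - γ) * (dualityMeasure p * (1 - α * (1 - σ)) - α * ((∑ i, v i) / n)) ≤
          (p.1 i + α * dir.1 i) * (p.2.2 i + α * dir.2.2 i)} := by
    ext α
    simp only [Set.mem_ofPred_eq, Set.mem_inter_iff]
    refine and_congr_right fun hα => ?_
    rw [mem_neighborhood_add_smul_iff h hp, h.dualityMeasure_add_smul]
    have hpos := h.dualityMeasure_add_smul_pos hγ1 hσ0 hp hv hα
    rw [h.dualityMeasure_add_smul] at hpos
    constructor
    · rintro ⟨h1, h2, h3⟩
      exact ⟨fun i => (h1 i).le, fun i => (h2 i).le, h3⟩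
    · rintro ⟨h1, h2, h3⟩
      have h4 : ∀ i, 0 < (p.1 i + α * dir.1 i) * (p.2.2 i + α * dir.2.2 i) := fun i =>
        lt_of_lt_of_le (mul_pos hγ hpos) (h3 i)
      exact ⟨fun i => (h1 i).lt_of_ne' (left_ne_zero_of_mul (h4 i).ne'),
        fun i => (h2 i).lt_of_ne' (right_ne_zero_of_mul (h4 i).ne'), h3⟩
  have hcomp : IsCompact {α : ℝ | α ∈ Set.Icc 0 1 ∧ p + α • dir ∈ neighborhood A b c γ} := by
    rw [hset]
    refine isCompact_Icc.inter_right ?_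
    simp only [Set.ofPred_and, Set.ofPred_forall]
    refine IsClosed.inter (isClosed_iInter fun i => isClosed_le (by fun_prop) (by fun_prop))
      (IsClosed.inter (isClosed_iInter fun i => isClosed_le (by fun_prop) (by fun_prop))
        (isClosed_iInter fun i => isClosed_le (by fun_prop) (by fun_prop)))
  exact hcomp.sSup_mem ⟨0, ⟨le_rfl, zero_le_one⟩, by simpa using hp⟩

/-- The duality gap is affine with negative slope along the direction, so the right endpoint is its
only minimiser. -/
theorem IsNewtonDirection.stepSize_eq (hσ1 : 0 < 1 - σ - γ * σ / 4)
    (h : IsNewtonDirection A σ p dir v) (hp : p ∈ neighborhood A b c γ)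
    (hv : ∀ i, |v i| ≤ γ * σ / 4 * dualityMeasure p) {a : ℝ} (ha : 0 ≤ a) :
    stepSize a p dir = a := by
  have hn : (0 : ℝ) < n := Nat.cast_pos.mpr (NeZero.pos n)
  have hμ := dualityMeasure_pos hp.1
  have hgap : ∀ α, (p + α • dir).1 ⬝ᵥ (p + α • dir).2.2 =
      n * (dualityMeasure p - α * (dualityMeasure p * (1 - σ) + (∑ i, v i) / n)) := fun α => by
    rw [dotProduct_eq_mul_dualityMeasure, h.dualityMeasure_add_smul]; ring
  have hslope : 0 < dualityMeasure p * (1 - σ) + (∑ i, v i) / n := by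
    have h1 := (abs_le.mp (abs_sum_div_le hv)).1
    nlinarith [mul_pos hμ hσ1]
  have hset : {α : ℝ | α ∈ Set.Icc 0 a ∧
      IsMinOn (fun β : ℝ => (p + β • dir).1 ⬝ᵥ (p + β • dir).2.2) (Set.Icc 0 a) α} = {a} := by
    ext α
    simp only [Set.mem_ofPred_eq, Set.mem_singleton_iff, hgap, isMinOn_iff]
    constructor
    · rintro ⟨h1, h2⟩
      have h3 := le_of_mul_le_mul_left (h2 a ⟨ha, le_rfl⟩) hn
      refine le_antisymm h1.2 (le_of_mul_le_mul_right ?_ hslope)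
      linarith
    · rintro rfl
      refine ⟨⟨ha, le_rfl⟩, fun β hβ => ?_⟩
      have := mul_le_mul_of_nonneg_right hβ.2 hslope.le
      exact mul_le_mul_of_nonneg_left (by linarith) hn.le
  rw [stepSize, hset, csInf_singleton]

/-- An approximate Newton step stays in the neighbourhood and decreases the duality measure. -/
theorem IsNewtonDirection.update (hγ0 : 0 < γ) (hγ1 : γ < 1) (hσ0 : 0 < σ) (hσ1 : σ < 4 / 5)
    (h : IsNewtonDirection A σ p dir v) (hp : p ∈ neighborhood A b c γ)
    (hv : ∀ i, |v i| ≤ γ * σ / 4 * dualityMeasure p) :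
    p + stepSize (maxStep A b c γ p dir) p dir • dir ∈ neighborhood A b c γ ∧
    dualityMeasure (p + stepSize (maxStep A b c γ p dir) p dir • dir) ≤
      (1 - decreaseRate γ σ / n) * dualityMeasure p := by
  have hn : (1 : ℝ) ≤ n := by exact_mod_cast NeZero.pos n
  have hμ := dualityMeasure_pos hp.1
  -- Here `σ < 4/5` enters: as `γ < 1`, the left-over slope exceeds `1 - 5σ/4`.
  have hκ : 0 < 1 - σ - γ * σ / 4 := by nlinarith
  have hmem := h.maxStep_mem hγ1 hσ0 hp hv
  rw [h.stepSize_eq hκ hp hv hmem.1.1]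
  refine ⟨hmem.2, (h.dualityMeasure_add_smul_le hv hmem.1.1).trans ?_⟩
  have hge : γ * σ * (1 - γ) / 10 / n ≤ maxStep A b c γ p dir := by
    have hnn : 0 ≤ γ * σ * (1 - γ) / 10 / n :=
      div_nonneg (div_nonneg (mul_nonneg (by positivity) (by linarith)) (by norm_num))
        (by linarith)
    refine le_csSup ⟨1, fun α hα => hα.1.2⟩ ⟨⟨hnn, ?_⟩, ?_⟩
    · rw [div_le_one (by linarith)]
      have : γ * σ < 1 := by nlinarith
      nlinarith
    · exact h.mem_neighborhood hγ0 hγ1 hσ0 (by linarith) hp hv ⟨hnn, le_rfl⟩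
  have h2 := mul_le_mul_of_nonneg_right hge hκ.le
  refine mul_le_mul_of_nonneg_right ?_ hμ.le
  have e : decreaseRate γ σ / n = γ * σ * (1 - γ) / 10 / n * (1 - σ - γ * σ / 4) := by
    rw [decreaseRate]; ring
  rw [e]
  linarith

end Update

end Step

/-! ### The computed direction is an approximate Newton direction -/

section Direction

variable {m n w : ℕ}

theorem normalMatrix_eq (A : Matrix (Fin m) (Fin n) ℝ) (p : Triplet m n) :
    normalMatrix A p = (A * scaling p) * (A * scaling p)ᵀ := by
  rw [normalMatrix, Matrix.transpose_mul, scaling, Matrix.diagonal_transpose]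
  simp only [Matrix.mul_assoc]

theorem transpose_mulVec_injective {A : Matrix (Fin m) (Fin n) ℝ} (hA : A.rank = m) :
    Function.Injective fun y => Aᵀ *ᵥ y := by
  have h : LinearIndependent ℝ A.row := by
    rw [linearIndependent_iff_card_eq_finrank_span, Fintype.card_fin, Set.finrank,
      ← Matrix.rank_eq_finrank_span_row, hA]
  simpa only [Matrix.mulVec_transpose] using Matrix.vecMul_injective_iff.mpr h

theorem normal_posDef {A : Matrix (Fin m) (Fin n) ℝ} (hA : A.rank = m) {b : Fin m → ℝ}
    {c : Fin n → ℝ} {p : Triplet m n} (hp : p ∈ strictlyFeasible A b c) :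
    ((A * scaling p) * (A * scaling p)ᵀ).PosDef := by
  refine gram_posDef fun y hy => ?_
  refine lt_of_le_of_ne (dotProduct_self_nonneg' _) fun h0 => hy ?_
  have h1 := dotProduct_self_eq_zero.mp h0.symm
  rw [Matrix.transpose_mul, ← Matrix.mulVec_mulVec, scaling, Matrix.diagonal_transpose] at h1
  refine transpose_mulVec_injective hA (a₁ := y) (a₂ := 0) ?_
  simp only [Matrix.mulVec_zero]
  ext i
  have h2 := congrFun h1 i
  rw [Matrix.mulVec_diagonal] at h2
  exact (mul_eq_zero.mp h2).resolve_left
    (div_pos (Real.sqrt_pos.mpr (hp.1 i)) (Real.sqrt_pos.mpr (hp.2.1 i))).ne'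

/-- The right-hand side of the Newton system in scaled variables. -/
noncomputable def scaledRhs (σ : ℝ) (p : Triplet m n) (i : Fin n) : ℝ :=
  √(p.1 i) * √(p.2.2 i) - σ * dualityMeasure p / (√(p.1 i) * √(p.2.2 i))

/-- Writing the right-hand side as `B g` with `B = A D` lets `GoodSketch.correction_bound` measure
it by `‖g‖`, which depends only on `x_i s_i` and `μ`. -/
theorem normalRhs_eq {A : Matrix (Fin m) (Fin n) ℝ} {b : Fin m → ℝ}
    {c : Fin n → ℝ} {p : Triplet m n} (hp : p ∈ strictlyFeasible A b c) (σ : ℝ) :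
    normalRhs A σ p = (A * scaling p) *ᵥ scaledRhs σ p := by
  rw [normalRhs, ← Matrix.mulVec_smul, ← Matrix.mulVec_sub, ← Matrix.mulVec_mulVec]
  congr 1
  ext i
  rw [scaling, Matrix.mulVec_diagonal, scaledRhs]
  have h1 := Real.sqrt_pos.mpr (hp.1 i)
  have h2 := Real.sqrt_pos.mpr (hp.2.1 i)
  have e1 := Real.sq_sqrt (hp.1 i).le
  have e2 := Real.sq_sqrt (hp.2.1 i).le
  simp only [Pi.sub_apply, Pi.smul_apply, smul_eq_mul]
  nth_rw 1 [← e1]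
  nth_rw 1 [← e2]
  field_simp

theorem scaledRhs_sq_le [NeZero n] {A : Matrix (Fin m) (Fin n) ℝ} {b : Fin m → ℝ}
    {c : Fin n → ℝ} {γ σ : ℝ} (hγ0 : 0 < γ) (hγ1 : γ < 1) (hσ0 : 0 < σ) (hσ1 : σ < 1)
    {p : Triplet m n} (hp : p ∈ neighborhood A b c γ) :
    scaledRhs σ p ⬝ᵥ scaledRhs σ p ≤ 4 / (1 - γ) * n * dualityMeasure p := by
  have hμ := dualityMeasure_pos hp.1
  have hγ : 0 < 1 - γ := by linarith
  have hbd : ∀ i, scaledRhs σ p i * scaledRhs σ p i ≤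
      2 * (p.1 i * p.2.2 i) + 2 / (1 - γ) * dualityMeasure p := fun i => by
    have hP : 0 < p.1 i * p.2.2 i := mul_pos (hp.1.1 i) (hp.1.2.1 i)
    have hPl := hp.2 i
    rw [scaledRhs, ← Real.sqrt_mul (hp.1.1 i).le]
    set P := p.1 i * p.2.2 i
    set μ := dualityMeasure p
    have h1 : √P ^ 2 = P := Real.sq_sqrt hP.le
    have h2 : (σ * μ / √P) ^ 2 ≤ 1 / (1 - γ) * μ := by
      rw [div_pow, h1, div_mul_eq_mul_div, one_mul, div_le_div_iff₀ hP hγ]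
      have h3 : (σ * μ) ^ 2 ≤ μ ^ 2 := by
        have : σ * μ ≤ μ := by nlinarith
        gcongr
      nlinarith
    have e : 2 / (1 - γ) * μ = 2 * (1 / (1 - γ) * μ) := by ring
    rw [e]
    nlinarith [sq_nonneg (√P + σ * μ / √P)]
  calc scaledRhs σ p ⬝ᵥ scaledRhs σ p
      ≤ ∑ i, (2 * (p.1 i * p.2.2 i) + 2 / (1 - γ) * dualityMeasure p) :=
        Finset.sum_le_sum fun i _ => hbd i
    _ = 2 * (n * dualityMeasure p) + n * (2 / (1 - γ) * dualityMeasure p) := by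
        rw [Finset.sum_add_distrib, ← Finset.mul_sum, ← dotProduct_eq_mul_dualityMeasure]
        simp [dotProduct]
    _ ≤ _ := by
        have h1 : 1 ≤ 1 / (1 - γ) := by rw [le_div_iff₀ hγ]; linarith
        have h2 : (0 : ℝ) ≤ n * dualityMeasure p := by positivity
        have h3 := mul_le_mul_of_nonneg_right h1 h2
        have e1 : 4 / (1 - γ) * n * dualityMeasure p =
          4 * (1 / (1 - γ) * (n * dualityMeasure p)) := by ring
        have e2 : n * (2 / (1 - γ) * dualityMeasure p) =
          2 * (1 / (1 - γ) * (n * dualityMeasure p)) := by ring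
        rw [e1, e2]
        linarith

/-- With `v = (XS)^{1/2} u` one has `S⁻¹ v = D u`, and `A D u` equals the residual of the normal
equations. It therefore cancels exactly in `A Δx`. The other two relations hold by construction, and
`v_i² = x_i s_i u_i² ≤ x_i s_i ‖u‖²`. -/
theorem direction_isNewtonDirection {A : Matrix (Fin m) (Fin n) ℝ} (hA : A.rank = m)
    {b : Fin m → ℝ} {c : Fin n → ℝ} {p : Triplet m n} (hp : p ∈ strictlyFeasible A b c)
    {σ : ℝ} {alg : Solver} {t r : ℕ} {W : Matrix (Fin n) (Fin w) ℝ}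
    (h : GoodSketch (orthonormalRows (A * scaling p)) m W)
    (h' : GoodSketch (1 : Matrix (Fin n) (Fin n) ℝ) r W) :
    IsNewtonDirection A σ p (direction A σ (1 / 2) alg t W p) (correction A σ (1 / 2) alg t W p) ∧
      ∀ i, correction A σ (1 / 2) alg t W p i ^ 2 ≤ p.1 i * p.2.2 i *
        ((2 + n) * (16 / 3 * (2 / 5) ^ t * (scaledRhs σ p ⬝ᵥ scaledRhs σ p))) := by
  have hB := normal_posDef hA hp
  obtain ⟨f, hf⟩ : ∃ f, f = normalMatrix A p *ᵥ deltaY A σ (1 / 2) alg t W p - normalRhs A σ p :=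
    ⟨_, rfl⟩
  obtain ⟨u, hu⟩ : ∃ u, u = W *ᵥ (pinv (A * scaling p * W) *ᵥ f) := ⟨_, rfl⟩
  have hv : ∀ i, correction A σ (1 / 2) alg t W p i = √(p.1 i * p.2.2 i) * u i := fun i => by
    rw [hu, hf]; rfl
  have hfB := hf
  rw [deltaY, normalMatrix_eq, normalRhs_eq hp] at hfB
  obtain ⟨h1, h2⟩ := h.correction_bound hB h' alg t (scaledRhs σ p) hfB hu
  constructor
  · refine ⟨?_, ?_, fun i => ?_⟩
    · set Δy := deltaY A σ (1 / 2) alg t W p with hΔy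
      have e : (direction A σ (1 / 2) alg t W p).1 =
          -p.1 + (σ * dualityMeasure p) • (fun i => (p.2.2 i)⁻¹) +
            (scaling p * scaling p) *ᵥ (Aᵀ *ᵥ Δy) - scaling p *ᵥ u := by
        ext i
        have hx := Real.sqrt_pos.mpr (hp.1 i)
        have hs := Real.sqrt_pos.mpr (hp.2.1 i)
        have e1 := Real.sq_sqrt (hp.1 i).le
        have e2 := Real.sq_sqrt (hp.2.1 i).le
        simp only [direction, hv, ← hΔy, scaling, Matrix.diagonal_mul_diagonal, Pi.add_apply,
          Pi.sub_apply, Pi.neg_apply, Pi.smul_apply, smul_eq_mul, Matrix.mulVec_diagonal]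
        rw [Real.sqrt_mul (hp.1 i).le]
        have h3 : √(p.1 i) / √(p.2.2 i) * (√(p.1 i) / √(p.2.2 i)) = p.1 i / p.2.2 i := by
          rw [div_mul_div_comm, ← pow_two, ← pow_two, e1, e2]
        have h4 : √(p.1 i) * √(p.2.2 i) * u i / p.2.2 i = √(p.1 i) / √(p.2.2 i) * u i := by
          nth_rw 2 [← e2]
          field_simp
        rw [h3, h4]
        ring
      rw [e, Matrix.mulVec_sub, Matrix.mulVec_add, Matrix.mulVec_add, Matrix.mulVec_neg,
        Matrix.mulVec_smul, Matrix.mulVec_mulVec u, h1, hf, Matrix.mulVec_mulVec,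
        Matrix.mulVec_mulVec, ← Matrix.mul_assoc, normalMatrix, normalRhs]
      simp only [Matrix.mul_assoc]
      abel
    · simp [direction]
    · have hs := (hp.2.1 i).ne'
      simp only [direction]
      field_simp
      ring
  · intro i
    rw [hv, mul_pow, Real.sq_sqrt (mul_pos (hp.1 i) (hp.2.1 i)).le]
    refine mul_le_mul_of_nonneg_left (le_trans ?_ h2) (mul_pos (hp.1 i) (hp.2.1 i)).le
    rw [pow_two]
    exact Finset.single_le_sum (f := fun i => u i * u i) (fun i _ => mul_self_nonneg (u i))
      (Finset.mem_univ i)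

theorem exists_inner_iterations_constant {L : ℝ} (hL : 0 < L) :
    ∃ C : ℝ, 0 < C ∧ ∀ n t : ℕ, 1 ≤ n → C * (1 + Real.log n) ≤ t →
      L * (n ^ 3 * (2 / 5) ^ t) ≤ 1 := by
  -- After taking logarithms the claim is `log L + 3 log n + t log (2/5) ≤ 0`. Since `log (2/5) ≤
  -- -1/2`, it suffices that `t ≥ 2 |log L| + 6 log n`.
  refine ⟨6 + 2 * |Real.log L|, by positivity, fun n t hn ht => ?_⟩
  have hn' : (1 : ℝ) ≤ n := by exact_mod_cast hn
  have hn0 : (0 : ℝ) < n := by linarith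
  have hlogn := Real.log_nonneg hn'
  have hpos : 0 < L * ((n : ℝ) ^ 3 * (2 / 5) ^ t) := by positivity
  rw [← Real.log_nonpos_iff hpos.le, Real.log_mul hL.ne' (by positivity),
    Real.log_mul (by positivity) (by positivity), Real.log_pow, Real.log_pow]
  have h25 : Real.log (2 / 5) ≤ -(1 / 2) := by
    rw [Real.log_le_iff_le_exp (by norm_num), Real.exp_neg, le_inv_comm₀ (by norm_num)
      (Real.exp_pos _)]
    have h := Real.exp_one_lt_d9
    have h2 : Real.exp (1 / 2) ^ 2 = Real.exp 1 := by rw [← Real.exp_nat_mul]; norm_num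
    nlinarith [Real.exp_pos (1 / 2)]
  have h1 := mul_le_mul_of_nonneg_left h25 (Nat.cast_nonneg (α := ℝ) t)
  have h2 := le_abs_self (Real.log L)
  have h3 := mul_nonneg (abs_nonneg (Real.log L)) hlogn
  push_cast
  nlinarith

/-- With good sketches and logarithmically many inner iterations, an outer iteration stays in the
neighbourhood and decreases the duality measure by a factor `1 - Ω(1/n)`. -/
theorem exists_outerStep_constant {γ σ : ℝ} (hγ0 : 0 < γ) (hγ1 : γ < 1) (hσ0 : 0 < σ)
    (hσ1 : σ < 4 / 5) :
    ∃ C : ℝ, 0 < C ∧ ∀ (alg : Solver) (m n w t r : ℕ) [NeZero n] (A : Matrix (Fin m) (Fin n) ℝ)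
      (b : Fin m → ℝ) (c : Fin n → ℝ) (p : Triplet m n) (W : Matrix (Fin n) (Fin w) ℝ),
      A.rank = m → p ∈ neighborhood A b c γ → C * (1 + Real.log n) ≤ t →
      GoodSketch (orthonormalRows (A * scaling p)) m W →
      GoodSketch (1 : Matrix (Fin n) (Fin n) ℝ) r W →
      outerStep A b c γ σ (1 / 2) alg t W p ∈ neighborhood A b c γ ∧
      dualityMeasure (outerStep A b c γ σ (1 / 2) alg t W p) ≤
        (1 - decreaseRate γ σ / n) * dualityMeasure p := by
  have hγ : 0 < 1 - γ := by linarith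
  -- `64 = 3 · (16/3) · 4`. The power `n³` collects `x_i s_i ≤ nμ`, `‖W‖² ≤ 3n` and `‖g‖² ≤
  -- 4nμ/(1-γ)`. The denominator is the square of the tolerance for `|v i| / μ`.
  obtain ⟨C, hC0, hC⟩ := exists_inner_iterations_constant
    (L := 64 / (1 - γ) / (γ * σ / 4) ^ 2) (by positivity)
  refine ⟨C, hC0, fun alg m n w t r _ A b c p W hA hp ht h h' => ?_⟩
  have hn : 1 ≤ n := NeZero.pos n
  have hn' : (1 : ℝ) ≤ n := by exact_mod_cast hn
  have hμ := dualityMeasure_pos hp.1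
  obtain ⟨h1, h2⟩ := direction_isNewtonDirection (σ := σ) (alg := alg) (t := t) hA hp.1 h h'
  refine h1.update hγ0 hγ1 hσ0 hσ1 hp fun i => ?_
  refine abs_le_of_sq_le_sq ((h2 i).trans ?_) (by positivity)
  have h3 := scaledRhs_sq_le hγ0 hγ1 hσ0 (by linarith) hp
  have h4 : p.1 i * p.2.2 i ≤ n * dualityMeasure p := by
    rw [← dotProduct_eq_mul_dualityMeasure]
    exact Finset.single_le_sum (f := fun i => p.1 i * p.2.2 i)
      (fun i _ => (mul_pos (hp.1.1 i) (hp.1.2.1 i)).le) (Finset.mem_univ i)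
  have h5 := hC n t hn ht
  rw [div_mul_eq_mul_div, div_le_one (by positivity)] at h5
  have h6 := (mul_pos (hp.1.1 i) (hp.1.2.1 i)).le
  have h7 := dotProduct_self_nonneg' (scaledRhs σ p)
  calc _ ≤ (n * dualityMeasure p) * ((3 * n) *
        (16 / 3 * (2 / 5) ^ t * (4 / (1 - γ) * n * dualityMeasure p))) := by
        gcongr
        linarith
    _ = (64 / (1 - γ) * (n ^ 3 * (2 / 5) ^ t)) * dualityMeasure p ^ 2 := by ring
    _ ≤ (γ * σ / 4) ^ 2 * dualityMeasure p ^ 2 := by gcongr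
    _ = _ := by ring

theorem decreaseRate_pos {γ σ : ℝ} (hγ0 : 0 < γ) (hγ1 : γ < 1) (hσ0 : 0 < σ) (hσ1 : σ < 4 / 5) :
    0 < decreaseRate γ σ := by
  have hκ : 0 < 1 - σ - γ * σ / 4 := by nlinarith
  have : 0 < 1 - γ := by linarith
  rw [decreaseRate]
  positivity

theorem decreaseRate_le_one {γ σ : ℝ} (hγ0 : 0 < γ) (hγ1 : γ < 1) (hσ0 : 0 < σ)
    (hσ1 : σ < 4 / 5) : decreaseRate γ σ ≤ 1 := by
  have hγσ : 0 < γ * σ := mul_pos hγ0 hσ0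
  have h1 : 1 - σ - γ * σ / 4 ≤ 1 := by linarith
  have h2 : γ * σ * (1 - γ) / 10 ≤ 1 := by nlinarith
  have h3 : 0 ≤ γ * σ * (1 - γ) / 10 := by
    have : 0 < 1 - γ := by linarith
    positivity
  rw [decreaseRate]
  nlinarith

end Direction

/-! ### Measurability of matrix operations -/

section MatrixMeasurability

variable {α : Type*} [MeasurableSpace α] {a b c : ℕ}

instance matrixBorelSpace (n w : ℕ) : BorelSpace (Matrix (Fin n) (Fin w) ℝ) :=
  inferInstanceAs (BorelSpace (Fin n → Fin w → ℝ))

theorem measurable_matrix_iff {f : α → Matrix (Fin a) (Fin b) ℝ} :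
    Measurable f ↔ ∀ i j, Measurable fun x => f x i j :=
  ⟨fun h i j => (measurable_pi_apply j).comp ((measurable_pi_apply i).comp h),
    fun h => measurable_pi_lambda _ fun i => measurable_pi_lambda _ fun j => h i j⟩

theorem measurable_dotProduct {f g : α → Fin a → ℝ} (hf : Measurable f) (hg : Measurable g) :
    Measurable fun x => f x ⬝ᵥ g x :=
  Finset.measurable_sum _ fun i _ =>
    ((measurable_pi_apply i).comp hf).mul ((measurable_pi_apply i).comp hg)

theorem measurable_mulVec {f : α → Matrix (Fin a) (Fin b) ℝ} {g : α → Fin b → ℝ}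
    (hf : Measurable f) (hg : Measurable g) : Measurable fun x => f x *ᵥ g x :=
  measurable_pi_lambda _ fun i => measurable_dotProduct ((measurable_pi_apply i).comp hf) hg

theorem measurable_matrix_mul {f : α → Matrix (Fin a) (Fin b) ℝ}
    {g : α → Matrix (Fin b) (Fin c) ℝ} (hf : Measurable f) (hg : Measurable g) :
    Measurable fun x => f x * g x := by
  rw [measurable_matrix_iff] at *
  intro i j
  simp only [Matrix.mul_apply]
  exact Finset.measurable_sum _ fun k _ => (hf i k).mul (hg k j)

theorem measurable_matrix_sub {f g : α → Matrix (Fin a) (Fin b) ℝ}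
    (hf : Measurable f) (hg : Measurable g) : Measurable fun x => f x - g x := by
  rw [measurable_matrix_iff] at *
  exact fun i j => (hf i j).sub (hg i j)

theorem measurable_transpose {f : α → Matrix (Fin a) (Fin b) ℝ} (hf : Measurable f) :
    Measurable fun x => (f x)ᵀ := by
  rw [measurable_matrix_iff] at *
  exact fun i j => hf j i

theorem measurable_specNorm : Measurable (specNorm (a := a) (b := b)) := by
  have h : Continuous fun Z : Matrix (Fin a) (Fin b) ℝ =>
      LinearMap.toContinuousLinearMap (Matrix.toEuclideanLin Z) :=
    LinearMap.continuous_of_finiteDimensional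
      (LinearMap.toContinuousLinearMap.toLinearMap ∘ₗ
        (Matrix.toEuclideanLin (𝕜 := ℝ) (m := Fin a) (n := Fin b)).toLinearMap)
  exact (continuous_norm.comp h).measurable

theorem measurable_frobSq : Measurable (frobSq (a := a) (b := b)) :=
  Finset.measurable_sum _ fun i _ => Finset.measurable_sum _ fun j _ =>
    (measurable_matrix_iff.mp measurable_id i j).pow_const 2

/-- In a fixed eigenbasis of `G` only the values at the eigenvalues matter, so pointwise convergence
is enough. -/
theorem tendsto_cfc_of_forall_tendsto {G : Matrix (Fin a) (Fin a) ℝ} (hG : G.IsHermitian)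
    {F : ℕ → ℝ → ℝ} {f : ℝ → ℝ}
    (h : ∀ x, Filter.Tendsto (fun k => F k x) Filter.atTop (nhds (f x))) :
    Filter.Tendsto (fun k => cfc (F k) G) Filter.atTop (nhds (cfc f G)) := by
  simp only [hG.cfc_eq, Matrix.IsHermitian.cfc, Unitary.conjStarAlgAut_apply]
  refine Filter.Tendsto.mul_const _ (Filter.Tendsto.const_mul _ ?_)
  have hcont : Continuous fun d : Fin a → ℝ => Matrix.diagonal d := by fun_prop
  refine (hcont.tendsto _).comp (tendsto_pi_nhds.mpr fun i => ?_)
  simpa using h _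

/-- A pointwise limit of continuous functions is a pointwise limit of polynomials. -/
theorem exists_polynomial_tendsto {F : ℕ → ℝ → ℝ} {f : ℝ → ℝ} (hF : ∀ k, Continuous (F k))
    (h : ∀ x, Filter.Tendsto (fun k => F k x) Filter.atTop (nhds (f x))) :
    ∃ p : ℕ → Polynomial ℝ,
      ∀ x, Filter.Tendsto (fun k => (p k).eval x) Filter.atTop (nhds (f x)) := by
  -- Weierstrass approximation on growing intervals with shrinking error; each `x` lies in all but
  -- finitely many of them.
  have hp : ∀ k : ℕ, ∃ p : Polynomial ℝ, ∀ x ∈ Set.Icc (-k : ℝ) k,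
      |p.eval x - F k x| < 1 / ((k : ℝ) + 1) := fun k =>
    exists_polynomial_near_of_continuousOn _ _ _ (hF k).continuousOn _ (by positivity)
  choose p hp using hp
  refine ⟨p, fun x => ?_⟩
  have h0 : Filter.Tendsto (fun k => (p k).eval x - F k x) Filter.atTop (nhds 0) := by
    refine squeeze_zero_norm' ?_ tendsto_one_div_add_atTop_nhds_zero_nat
    obtain ⟨N, hN⟩ := exists_nat_ge |x|
    filter_upwards [Filter.eventually_ge_atTop N] with k hk
    have hk' : |x| ≤ k := hN.trans (by exact_mod_cast hk)
    exact (hp k x (abs_le.mp hk')).le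
  simpa using h0.add (h x)

/-- The functional calculus of a Baire-one function is measurable. -/
theorem measurable_cfc {G : α → Matrix (Fin a) (Fin a) ℝ} (hG : Measurable G)
    (hH : ∀ x, (G x).IsHermitian) {F : ℕ → ℝ → ℝ} {f : ℝ → ℝ} (hF : ∀ k, Continuous (F k))
    (h : ∀ x, Filter.Tendsto (fun k => F k x) Filter.atTop (nhds (f x))) :
    Measurable fun x => cfc f (G x) := by
  obtain ⟨p, hp⟩ := exists_polynomial_tendsto hF h
  rw [measurable_matrix_iff]
  intro i j
  refine measurable_of_tendsto_metrizable (f := fun k x => (Polynomial.aeval (G x) (p k)) i j)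
    (fun k => ?_) (tendsto_pi_nhds.mpr fun x => ?_)
  · exact measurable_matrix_iff.mp ((p k).continuous_aeval.measurable.comp hG) i j
  · have h1 := tendsto_cfc_of_forall_tendsto (hH x) hp
    have h2 := tendsto_pi_nhds.mp (tendsto_pi_nhds.mp h1 i) j
    refine h2.congr fun k => ?_
    rw [cfc_polynomial (p k) (G x) (hH x).isSelfAdjoint]

/-- The function `(√x)⁻¹` jumps at `0` but is Baire one. The regularised quotients are continuous
and converge everywhere, including to the default value `0` for `x ≤ 0`. -/
theorem measurable_invSqrtGram {B : α → Matrix (Fin a) (Fin b) ℝ} (hB : Measurable B) :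
    Measurable fun x => invSqrtGram (B x) := by
  refine measurable_cfc (measurable_matrix_mul hB (measurable_transpose hB))
    (fun x => gram_isHermitian (B x))
    (F := fun k x => √x / (|x| + 1 / ((k : ℝ) + 1))) (fun k => ?_) fun x => ?_
  · refine Continuous.div (by fun_prop) (by fun_prop) fun x => ?_
    positivity
  · rcases le_or_gt x 0 with hx | hx
    · simp [Real.sqrt_eq_zero_of_nonpos hx]
    · have h1 : (√x)⁻¹ = √x / (|x| + 0) := by
        rw [abs_of_pos hx, add_zero, Real.sqrt_div_self]
      rw [h1]
      exact tendsto_const_nhds.div (tendsto_const_nhds.add tendsto_one_div_add_atTop_nhds_zero_nat)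
        (by rw [add_zero]; exact abs_ne_zero.mpr hx.ne')

theorem measurable_pinv {B : α → Matrix (Fin a) (Fin b) ℝ} (hB : Measurable B) :
    Measurable fun x => pinv (B x) := by
  refine measurable_matrix_mul (measurable_transpose hB)
    (measurable_cfc (measurable_matrix_mul hB (measurable_transpose hB))
    (fun x => gram_isHermitian (B x))
    (F := fun k x => x / (x ^ 2 + 1 / ((k : ℝ) + 1))) (fun k => ?_) fun x => ?_)
  · refine Continuous.div (by fun_prop) (by fun_prop) fun x => ?_
    positivity
  · rcases eq_or_ne x 0 with rfl | hx
    · simp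
    · have h1 : x⁻¹ = x / (x ^ 2 + 0) := by
        rw [add_zero]; field_simp
      rw [h1]
      exact tendsto_const_nhds.div (tendsto_const_nhds.add tendsto_one_div_add_atTop_nhds_zero_nat)
        (by rw [add_zero]; exact pow_ne_zero 2 hx)

theorem measurable_goodSketch {d n w : ℕ} {Z : α → Matrix (Fin d) (Fin n) ℝ}
    {W : α → Matrix (Fin n) (Fin w) ℝ} (hZ : Measurable Z) (hW : Measurable W) (r : ℕ) :
    MeasurableSet {x | GoodSketch (Z x) r (W x)} := by
  refine measurableSet_le (measurable_specNorm.comp (measurable_matrix_sub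
    (measurable_matrix_mul (measurable_matrix_mul (measurable_matrix_mul hZ hW)
      (measurable_transpose hW)) (measurable_transpose hZ))
    (measurable_matrix_mul hZ (measurable_transpose hZ)))) ?_
  exact (((measurable_specNorm.comp hZ).pow_const 2).add
    ((measurable_frobSq.comp hZ).div_const _)).const_mul _

end MatrixMeasurability

/-! ### Measurability of the inner solvers -/

section SolverMeasurability

variable {α : Type*} [MeasurableSpace α] {m : ℕ}

theorem measurable_cg {M : α → Matrix (Fin m) (Fin m) ℝ} {q : α → Fin m → ℝ}
    (hM : Measurable M) (hq : Measurable q) (t : ℕ) : Measurable fun x => cg (M x) (q x) t := by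
  have key : ∀ t : ℕ, (Measurable fun x => ((cgStep (M x))^[t] ⟨0, q x, q x⟩).z) ∧
      (Measurable fun x => ((cgStep (M x))^[t] ⟨0, q x, q x⟩).r) ∧
      Measurable fun x => ((cgStep (M x))^[t] ⟨0, q x, q x⟩).d := by
    intro t
    induction t with
    | zero => exact ⟨measurable_const, hq, hq⟩
    | succ t ih =>
      obtain ⟨hz, hr, hd⟩ := ih
      simp only [Function.iterate_succ_apply']
      have hMd := measurable_mulVec hM hd
      have ha := (measurable_dotProduct hr hr).div (measurable_dotProduct hd hMd)
      have hr' := hr.sub (ha.smul hMd)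
      have hb := (measurable_dotProduct hr' hr').div (measurable_dotProduct hr hr)
      exact ⟨hz.add (ha.smul hd), hr', hr'.add (hb.smul hd)⟩
  exact (key t).1

theorem measurable_chebyshev {M : α → Matrix (Fin m) (Fin m) ℝ} {q : α → Fin m → ℝ} (lo hi : ℝ)
    (hM : Measurable M) (hq : Measurable q) (t : ℕ) :
    Measurable fun x => chebyshev lo hi (M x) (q x) t := by
  let s : α → ChebState m := fun x =>
    ⟨0, q x, ((hi + lo) / 2)⁻¹ • q x, ((hi - lo) / 2) / ((hi + lo) / 2)⟩
  have key : ∀ t : ℕ, (Measurable fun x => ((chebStep lo hi (M x))^[t] (s x)).z) ∧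
      (Measurable fun x => ((chebStep lo hi (M x))^[t] (s x)).r) ∧
      (Measurable fun x => ((chebStep lo hi (M x))^[t] (s x)).d) ∧
      Measurable fun x => ((chebStep lo hi (M x))^[t] (s x)).ρ := by
    intro t
    induction t with
    | zero => exact ⟨measurable_const, hq, hq.const_smul ((hi + lo) / 2)⁻¹, measurable_const⟩
    | succ t ih =>
      obtain ⟨hz, hr, hd, hρ⟩ := ih
      simp only [Function.iterate_succ_apply']
      have hr' := hr.sub (measurable_mulVec hM hd)
      have hρ' : Measurable fun x => 1 / (2 * (((hi + lo) / 2) / ((hi - lo) / 2)) -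
          ((chebStep lo hi (M x))^[t] (s x)).ρ) := (hρ.const_sub _).const_div _
      exact ⟨hz.add hd, hr', ((hρ'.mul hρ).smul hd).add
        (((hρ'.const_mul 2).div_const _).smul hr'), hρ'⟩
  exact (key t).1

theorem measurable_solve (alg : Solver) (ζ : ℝ) {M : α → Matrix (Fin m) (Fin m) ℝ}
    {q : α → Fin m → ℝ} (hM : Measurable M) (hq : Measurable q) (t : ℕ) :
    Measurable fun x => alg.solve ζ (M x) (q x) t := by
  cases alg with
  | conjugateGradient => exact measurable_cg hM hq t
  | chebyshevIteration => exact measurable_chebyshev _ _ hM hq t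

end SolverMeasurability

/-! ### Measurability of the step size -/

section Projection

variable {X : Type*} [TopologicalSpace X]

/-- Projection along a compact factor is a closed map. -/
theorem isClosed_exists_mem_compact {K : Set ℝ} (hK : IsCompact K) {C : Set (X × ℝ)}
    (hC : IsClosed C) : IsClosed {x | ∃ α ∈ K, (x, α) ∈ C} := by
  have : CompactSpace K := isCompact_iff_compactSpace.mp hK
  have h := isClosedMap_fst_of_compactSpace (X := X) (Y := K)
    _ (hC.preimage (f := fun z : X × K => (z.1, (z.2 : ℝ))) (by fun_prop))
  convert h using 1
  ext x
  simp

variable [MeasurableSpace X] [OpensMeasurableSpace X]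

/-- Sections of an `F_σ` set meet a fixed `F_σ` set of reals in a measurable set of cases. -/
theorem measurableSet_exists_mem {K : ℕ → Set ℝ} (hK : ∀ k, IsCompact (K k))
    {C : ℕ → Set (X × ℝ)} (hC : ∀ j, IsClosed (C j)) :
    MeasurableSet {x | ∃ α ∈ ⋃ k, K k, (x, α) ∈ ⋃ j, C j} := by
  have h : {x | ∃ α ∈ ⋃ k, K k, (x, α) ∈ ⋃ j, C j} =
      ⋃ k, ⋃ j, {x | ∃ α ∈ K k, (x, α) ∈ C j} := by
    ext x
    simp only [Set.mem_ofPred_eq, Set.mem_iUnion]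
    constructor
    · rintro ⟨α, ⟨k, hk⟩, j, hj⟩; exact ⟨k, j, α, hk, hj⟩
    · rintro ⟨k, j, α, hk, hj⟩; exact ⟨α, ⟨k, hk⟩, j, hj⟩
  rw [h]
  exact MeasurableSet.iUnion fun k => MeasurableSet.iUnion fun j =>
    (isClosed_exists_mem_compact (hK k) (hC j)).measurableSet

theorem iUnion_Icc_add_eq_Ioc (a b : ℝ) :
    ⋃ k : ℕ, Set.Icc (a + 1 / ((k : ℝ) + 1)) b = Set.Ioc a b := by
  ext x
  simp only [Set.mem_iUnion, Set.mem_Icc, Set.mem_Ioc]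
  constructor
  · rintro ⟨k, h1, h2⟩
    have : (0 : ℝ) < 1 / ((k : ℝ) + 1) := by positivity
    exact ⟨by linarith, h2⟩
  · rintro ⟨h1, h2⟩
    obtain ⟨k, hk⟩ := exists_nat_one_div_lt (sub_pos.mpr h1)
    exact ⟨k, by linarith, h2⟩

theorem iUnion_Icc_sub_eq_Ico (a b : ℝ) :
    ⋃ k : ℕ, Set.Icc a (b - 1 / ((k : ℝ) + 1)) = Set.Ico a b := by
  ext x
  simp only [Set.mem_iUnion, Set.mem_Icc, Set.mem_Ico]
  constructor
  · rintro ⟨k, h1, h2⟩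
    have : (0 : ℝ) < 1 / ((k : ℝ) + 1) := by positivity
    exact ⟨h1, by linarith⟩
  · rintro ⟨h1, h2⟩
    obtain ⟨k, hk⟩ := exists_nat_one_div_lt (sub_pos.mpr h2)
    exact ⟨k, h1, by linarith⟩

/-- For `c ≥ 0` the supremum exceeds `c` exactly when the section meets `(c, 1]`, a countable union
of compact intervals. Projecting along these avoids analytic sets. -/
theorem measurable_sSup_section {C : ℕ → Set (X × ℝ)} (hC : ∀ j, IsClosed (C j)) :
    Measurable fun x => sSup {α : ℝ | α ∈ Set.Icc 0 1 ∧ (x, α) ∈ ⋃ j, C j} := by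
  refine measurable_of_Ioi fun c => ?_
  have hbdd : ∀ x, BddAbove {α : ℝ | α ∈ Set.Icc 0 1 ∧ (x, α) ∈ ⋃ j, C j} := fun x =>
    ⟨1, fun α hα => hα.1.2⟩
  rcases lt_or_ge c 0 with hc | hc
  -- For `c < 0` every point qualifies, empty sections included, because `sSup ∅ = 0`.
  · convert MeasurableSet.univ (α := X)
    ext x
    simp only [Set.mem_preimage, Set.mem_Ioi, Set.mem_univ, iff_true]
    exact hc.trans_le (Real.sSup_nonneg fun α hα => hα.1.1)
  · convert measurableSet_exists_mem (fun k : ℕ => isCompact_Icc (a := c + 1 / ((k : ℝ) + 1))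
      (b := 1)) hC using 1
    ext x
    rw [iUnion_Icc_add_eq_Ioc]
    simp only [Set.mem_preimage, Set.mem_Ioi, Set.mem_ofPred_eq]
    constructor
    · intro h
      have hne : {α : ℝ | α ∈ Set.Icc 0 1 ∧ (x, α) ∈ ⋃ j, C j}.Nonempty := by
        by_contra hne
        rw [Set.not_nonempty_iff_eq_empty] at hne
        rw [hne, Real.sSup_empty] at h
        linarith
      obtain ⟨α, hα, hcα⟩ := (lt_csSup_iff (hbdd x) hne).mp h
      exact ⟨α, ⟨hcα, hα.1.2⟩, hα.2⟩
    · rintro ⟨α, hα, hT⟩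
      exact hα.1.trans_le (le_csSup (hbdd x) ⟨⟨hc.trans hα.1.le, hα.2⟩, hT⟩)

theorem measurable_sInf_section {C : Set (X × ℝ)} (hC : IsClosed C)
    (h0 : ∀ x α, (x, α) ∈ C → 0 ≤ α) :
    Measurable fun x => sInf {α : ℝ | (x, α) ∈ C} := by
  refine measurable_of_Iio fun c => ?_
  have hbdd : ∀ x, BddBelow {α : ℝ | (x, α) ∈ C} := fun x => ⟨0, fun α hα => h0 x α hα⟩
  have hlt : MeasurableSet {x | ∃ α ∈ Set.Ico 0 c, (x, α) ∈ C} := by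
    have := measurableSet_exists_mem (fun k : ℕ => isCompact_Icc (a := 0)
      (b := c - 1 / ((k : ℝ) + 1))) (C := fun _ => C) fun _ => hC
    rwa [iUnion_Icc_sub_eq_Ico, Set.iUnion_const] at this
  have hne : MeasurableSet {x | ∃ α, (x, α) ∈ C} := by
    have := measurableSet_exists_mem (fun k : ℕ => isCompact_Icc (a := -(k : ℝ)) (b := k))
      (C := fun _ => C) fun _ => hC
    rw [Set.iUnion_const] at this
    convert this using 1
    ext x
    simp only [Set.mem_ofPred_eq]
    constructor
    · rintro ⟨α, hα⟩
      obtain ⟨k, hk⟩ := exists_nat_ge |α|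
      exact ⟨α, Set.mem_iUnion.mpr ⟨k, abs_le.mp hk⟩, hα⟩
    · rintro ⟨α, -, hα⟩
      exact ⟨α, hα⟩
  rcases le_or_gt c 0 with hc | hc
  · convert MeasurableSet.empty (α := X)
    ext x
    simp only [Set.mem_preimage, Set.mem_Iio, Set.mem_empty_iff_false, iff_false, not_lt]
    exact hc.trans (Real.sInf_nonneg fun α hα => h0 x α hα)
  -- Empty sections count as well, since `sInf ∅ = 0 < c`.
  · convert hlt.union hne.compl using 1
    ext x
    simp only [Set.mem_preimage, Set.mem_Iio, Set.mem_union, Set.mem_ofPred_eq, Set.mem_compl_iff]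
    by_cases hx : ∃ α, (x, α) ∈ C
    · simp only [hx, not_true_eq_false, or_false]
      rw [csInf_lt_iff (hbdd x) hx]
      constructor
      · rintro ⟨α, h1, h2⟩; exact ⟨α, ⟨h0 x α h1, h2⟩, h1⟩
      · rintro ⟨α, h1, h2⟩; exact ⟨α, h2, h1.2⟩
    · have : {α : ℝ | (x, α) ∈ C} = ∅ := by
        ext α; simp only [Set.mem_ofPred_eq, Set.mem_empty_iff_false, iff_false]
        exact fun h => hx ⟨α, h⟩
      simp only [hx, not_false_eq_true, or_true, iff_true]
      rw [this, Real.sInf_empty]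
      exact hc

end Projection

/-! ### Measurability of the outer step and of the iterates -/

section StepMeasurability

variable {m n w : ℕ}

/-- Strict positivity is exhausted by the closed conditions `1/(j+1) ≤ x_i, s_i`; one `j` serves all
of the finitely many coordinates. -/
theorem neighborhood_eq_iUnion (A : Matrix (Fin m) (Fin n) ℝ) (b : Fin m → ℝ) (c : Fin n → ℝ)
    (γ : ℝ) : ∃ C : ℕ → Set (Triplet m n), (∀ j, IsClosed (C j)) ∧
      neighborhood A b c γ = ⋃ j, C j := by
  refine ⟨fun j => {p | (∀ i, 1 / ((j : ℝ) + 1) ≤ p.1 i) ∧ (∀ i, 1 / ((j : ℝ) + 1) ≤ p.2.2 i) ∧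
    A *ᵥ p.1 = b ∧ Aᵀ *ᵥ p.2.1 + p.2.2 = c ∧
    ∀ i, (1 - γ) * (p.1 ⬝ᵥ p.2.2 / n) ≤ p.1 i * p.2.2 i}, fun j => ?_, ?_⟩
  · simp only [Set.ofPred_and, Set.ofPred_forall]
    refine IsClosed.inter (isClosed_iInter fun i => isClosed_le (by fun_prop) (by fun_prop))
      (IsClosed.inter (isClosed_iInter fun i => isClosed_le (by fun_prop) (by fun_prop))
      (IsClosed.inter (isClosed_eq (by fun_prop) (by fun_prop))
      (IsClosed.inter (isClosed_eq (by fun_prop) (by fun_prop))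
      (isClosed_iInter fun i => isClosed_le (by fun_prop) (by fun_prop)))))
  · ext p
    simp only [Set.mem_iUnion, Set.mem_ofPred_eq]
    constructor
    · rintro ⟨⟨h1, h2, h3, h4⟩, h5⟩
      have hev : ∀ a : ℝ, 0 < a → ∀ᶠ j : ℕ in Filter.atTop, 1 / ((j : ℝ) + 1) ≤ a := fun a ha =>
        (tendsto_one_div_add_atTop_nhds_zero_nat (𝕜 := ℝ)).eventually_le_const ha
      obtain ⟨j, h6, h7⟩ := ((Filter.eventually_all.mpr fun i => hev _ (h1 i)).and
        (Filter.eventually_all.mpr fun i => hev _ (h2 i))).exists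
      exact ⟨j, h6, h7, h3, h4, h5⟩
    · rintro ⟨j, h1, h2, h3, h4, h5⟩
      have hj : (0 : ℝ) < 1 / ((j : ℝ) + 1) := by positivity
      exact ⟨⟨fun i => hj.trans_le (h1 i), fun i => hj.trans_le (h2 i), h3, h4⟩, h5⟩

theorem measurable_maxStep (A : Matrix (Fin m) (Fin n) ℝ) (b : Fin m → ℝ) (c : Fin n → ℝ)
    (γ : ℝ) : Measurable fun z : Triplet m n × Triplet m n => maxStep A b c γ z.1 z.2 := by
  obtain ⟨C, hC, hN⟩ := neighborhood_eq_iUnion A b c γ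
  have h := measurable_sSup_section (X := Triplet m n × Triplet m n)
    (C := fun j => {z | z.1.1 + z.2 • z.1.2 ∈ C j}) fun j => (hC j).preimage (by fun_prop)
  convert h using 2 with z
  rw [maxStep, hN]
  congr 1
  ext α
  simp

/-- Writing the competitors as `amax · τ` with `τ ∈ [0, 1]` makes the index set independent of the
data. Being a minimiser is then a closed joint condition, being an intersection of closed ones. -/
theorem measurable_stepSize :
    Measurable fun z : ℝ × Triplet m n × Triplet m n => stepSize z.1 z.2.1 z.2.2 := by
  let g : (ℝ × Triplet m n × Triplet m n) → ℝ → ℝ := fun z β =>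
    (z.2.1 + β • z.2.2).1 ⬝ᵥ (z.2.1 + β • z.2.2).2.2
  have hg : Continuous fun y : (ℝ × Triplet m n × Triplet m n) × ℝ => g y.1 y.2 := by
    simp only [g, dotProduct]; fun_prop
  have hC : IsClosed {y : (ℝ × Triplet m n × Triplet m n) × ℝ | 0 ≤ y.2 ∧ y.2 ≤ y.1.1 ∧
      ∀ τ : Set.Icc (0 : ℝ) 1, g y.1 y.2 ≤ g y.1 (y.1.1 * τ)} := by
    simp only [Set.ofPred_and, Set.ofPred_forall]
    refine (isClosed_le (by fun_prop) (by fun_prop)).inter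
      ((isClosed_le (by fun_prop) (by fun_prop)).inter (isClosed_iInter fun τ => ?_))
    exact isClosed_le hg (hg.comp (f := fun y : (ℝ × Triplet m n × Triplet m n) × ℝ => (y.1, y.1.1 * (τ : ℝ))) (by fun_prop))
  convert measurable_sInf_section hC fun x α h => h.1 using 2 with z
  rw [stepSize]
  congr 1
  ext α
  simp only [Set.mem_ofPred_eq, isMinOn_iff, Set.mem_Icc, and_assoc]
  refine and_congr_right fun h1 => and_congr_right fun h2 => ?_
  constructor
  · intro h τ
    exact h _ ⟨mul_nonneg (h1.trans h2) τ.2.1, mul_le_of_le_one_right (h1.trans h2) τ.2.2⟩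
  · intro h β hβ
    rcases (h1.trans h2).eq_or_lt with h0 | h0
    · have e1 : β = 0 := le_antisymm (h0 ▸ hβ.2) hβ.1
      have e2 : α = 0 := le_antisymm (h0 ▸ h2) h1
      rw [e1, e2]
    · have h3 := h ⟨β / z.1, div_nonneg hβ.1 h0.le, (div_le_one h0).mpr hβ.2⟩
      rwa [mul_div_cancel₀ _ h0.ne'] at h3

variable {α : Type*} [MeasurableSpace α]

theorem measurable_dualityMeasure : Measurable (dualityMeasure (m := m) (n := n)) :=
  (measurable_dotProduct measurable_fst measurable_snd.snd).div_const _

theorem measurable_scaling : Measurable (scaling (m := m) (n := n)) := by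
  rw [measurable_matrix_iff]
  intro i j
  simp only [scaling, Matrix.diagonal_apply]
  split_ifs
  · exact ((measurable_pi_apply i).comp measurable_fst).sqrt.div
      ((measurable_pi_apply i).comp measurable_snd.snd).sqrt
  · exact measurable_const

theorem measurable_normalMatrix (A : Matrix (Fin m) (Fin n) ℝ) : Measurable (normalMatrix A) :=
  measurable_matrix_mul (measurable_matrix_mul measurable_const
    (measurable_matrix_mul measurable_scaling measurable_scaling)) measurable_const

theorem measurable_normalRhs (A : Matrix (Fin m) (Fin n) ℝ) (σ : ℝ) :
    Measurable (normalRhs A σ) := by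
  refine (measurable_mulVec measurable_const measurable_fst).sub
    ((measurable_dualityMeasure.const_mul σ).smul
      (measurable_mulVec measurable_const (measurable_pi_lambda _ fun i => ?_)))
  exact ((measurable_pi_apply i).comp measurable_snd.snd).inv

theorem measurable_direction (A : Matrix (Fin m) (Fin n) ℝ) (σ ζ : ℝ) (alg : Solver) (t : ℕ)
    {W : α → Matrix (Fin n) (Fin w) ℝ} {p : α → Triplet m n} (hW : Measurable W)
    (hp : Measurable p) : Measurable fun x => direction A σ ζ alg t (W x) (p x) := by
  have hADW : Measurable fun x => A * scaling (p x) * W x :=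
    measurable_matrix_mul (measurable_matrix_mul measurable_const (measurable_scaling.comp hp)) hW
  have hR := measurable_invSqrtGram hADW
  have hN := (measurable_normalMatrix A).comp hp
  have hq := (measurable_normalRhs A σ).comp hp
  have hΔy : Measurable fun x => deltaY A σ ζ alg t (W x) (p x) :=
    measurable_mulVec hR (measurable_solve alg ζ
      (measurable_matrix_mul (measurable_matrix_mul hR hN) hR) (measurable_mulVec hR hq) t)
  have hx : ∀ i, Measurable fun x => (p x).1 i := fun i => (measurable_pi_apply i).comp hp.fst
  have hs : ∀ i, Measurable fun x => (p x).2.2 i := fun i =>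
    (measurable_pi_apply i).comp hp.snd.snd
  have hv : ∀ i, Measurable fun x => correction A σ ζ alg t (W x) (p x) i := fun i =>
    ((hx i).mul (hs i)).sqrt.mul ((measurable_pi_apply i).comp
      (measurable_mulVec hW (measurable_mulVec (measurable_pinv hADW)
        ((measurable_mulVec hN hΔy).sub hq))))
  have hΔs : Measurable fun x => -(Aᵀ *ᵥ deltaY A σ ζ alg t (W x) (p x)) :=
    (measurable_mulVec measurable_const hΔy).neg
  refine Measurable.prodMk (measurable_pi_lambda _ fun i => ?_) (hΔy.prodMk hΔs)
  exact (((hx i).neg.add (((measurable_dualityMeasure.comp hp).const_mul σ).div (hs i))).sub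
    (((hx i).div (hs i)).mul ((measurable_pi_apply i).comp hΔs))).sub ((hv i).div (hs i))

theorem measurable_outerStep (A : Matrix (Fin m) (Fin n) ℝ) (b : Fin m → ℝ) (c : Fin n → ℝ)
    (γ σ ζ : ℝ) (alg : Solver) (t : ℕ)
    {W : α → Matrix (Fin n) (Fin w) ℝ} {p : α → Triplet m n} (hW : Measurable W)
    (hp : Measurable p) : Measurable fun x => outerStep A b c γ σ ζ alg t (W x) (p x) := by
  have hd := measurable_direction A σ ζ alg t hW hp
  have hmax := (measurable_maxStep A b c γ).comp (hp.prodMk hd)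
  exact hp.add ((measurable_stepSize.comp (hmax.prodMk (hp.prodMk hd))).smul hd)

theorem measurable_ipm (A : Matrix (Fin m) (Fin n) ℝ) (b : Fin m → ℝ) (c : Fin n → ℝ)
    (γ σ ζ : ℝ) (alg : Solver) (t : ℕ) (tol : ℝ) (start : Triplet m n)
    {W : α → ℕ → Matrix (Fin n) (Fin w) ℝ} (hW : ∀ j, Measurable fun x => W x j) (k : ℕ) :
    Measurable fun x => ipm A b c γ σ ζ alg t tol (W x) start k := by
  induction k with
  | zero => exact measurable_const
  | succ k ih =>
    simp only [ipm]
    exact Measurable.ite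
      (measurableSet_lt measurable_const (measurable_dualityMeasure.comp ih))
      (measurable_outerStep A b c γ σ ζ alg t (hW k) ih) ih

end StepMeasurability

/-! ### Failure probability -/

section Probability

variable {m n w : ℕ}

/-- The `k`-th iterate sees only the first `k` sketches, which is why it is independent of `W k`. -/
theorem ipm_congr (A : Matrix (Fin m) (Fin n) ℝ) (b : Fin m → ℝ) (c : Fin n → ℝ)
    (γ σ ζ : ℝ) (alg : Solver) (t : ℕ) (tol : ℝ) (start : Triplet m n)
    {W W' : ℕ → Matrix (Fin n) (Fin w) ℝ} {k : ℕ} (h : ∀ j < k, W j = W' j) :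
    ipm A b c γ σ ζ alg t tol W start k = ipm A b c γ σ ζ alg t tol W' start k := by
  induction k with
  | zero => rfl
  | succ k ih =>
    simp only [ipm]
    rw [ih fun j hj => h j (hj.trans k.lt_succ_self), h k k.lt_succ_self]

variable {Ω : Type*} [MeasurableSpace Ω] {P : Measure Ω}

/-- The current iterate is independent of the fresh sketching matrix. -/
theorem indepFun_ipm (A : Matrix (Fin m) (Fin n) ℝ) (b : Fin m → ℝ) (c : Fin n → ℝ)
    (γ σ ζ : ℝ) (alg : Solver) (t : ℕ) (tol : ℝ) (start : Triplet m n)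
    {W : ℕ → Ω → Matrix (Fin n) (Fin w) ℝ} (hW : ∀ k, Measurable (W k)) (hind : iIndepFun W P)
    (k : ℕ) :
    IndepFun (fun ω => ipm A b c γ σ ζ alg t tol (fun j => W j ω) start k) (W k) P := by
  have h := hind.indepFun_finset (Finset.range k) {k} (by simp) hW
  -- A finite tuple of sketches is padded with zeros to a sequence, so that the iterate factors
  -- through the first `k` sketches.
  let V : (Finset.range k → Matrix (Fin n) (Fin w) ℝ) → ℕ → Matrix (Fin n) (Fin w) ℝ :=
    fun U j => if hj : j ∈ Finset.range k then U ⟨j, hj⟩ else 0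
  have hV : ∀ j, Measurable fun U => V U j := fun j => by
    by_cases hj : j ∈ Finset.range k
    · simp only [V, hj, dif_pos]; exact measurable_pi_apply _
    · simp only [V, hj]; exact measurable_const
  have h2 := h.comp (measurable_ipm A b c γ σ ζ alg t tol start hV k)
    (measurable_pi_apply (⟨k, Finset.mem_singleton_self k⟩ : ({k} : Finset ℕ)))
  convert h2 using 1
  · ext1 ω
    refine ipm_congr A b c γ σ ζ alg t tol start fun j hj => ?_
    simp [V, hj]
  · rfl

variable [IsProbabilityMeasure P]

theorem IsSketchingMatrix.measure_not_goodSketch_le {W : Ω → Matrix (Fin n) (Fin w) ℝ} {δ : ℝ}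
    {r d : ℕ} (h : IsSketchingMatrix P W (1 / 2) δ r) (Z : Matrix (Fin d) (Fin n) ℝ) :
    P.real {ω | ¬ GoodSketch Z r (W ω)} ≤ δ := by
  have h1 : 1 - δ ≤ P.real {ω | GoodSketch Z r (W ω)} := h.2 d Z
  have h2 := probReal_compl_eq_one_sub (μ := P)
    (measurable_goodSketch (Z := fun _ => Z) measurable_const h.1 r)
  have h3 : {ω | ¬ GoodSketch Z r (W ω)} = {ω | GoodSketch Z r (W ω)}ᶜ := rfl
  rw [h3, h2]
  linarith

/-- The guarantee for fixed matrices extends to independent random matrices. -/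
theorem IsSketchingMatrix.measure_not_goodSketch_le_of_indepFun {X : Type*} [MeasurableSpace X]
    {W : Ω → Matrix (Fin n) (Fin w) ℝ} {δ : ℝ} {r d : ℕ}
    (h : IsSketchingMatrix P W (1 / 2) δ r) {p : Ω → X} (hp : Measurable p)
    (hind : IndepFun p W P) {Z : X → Matrix (Fin d) (Fin n) ℝ} (hZ : Measurable Z) :
    P.real {ω | ¬ GoodSketch (Z (p ω)) r (W ω)} ≤ δ := by
  -- Nonnegativity of `δ` is read off from the guarantee itself, applied to a matrix without rows.
  have hδ : 0 ≤ δ := measureReal_nonneg.trans (h.measure_not_goodSketch_le (0 : Matrix (Fin 0) _ ℝ))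
  have hB : MeasurableSet {y : X × Matrix (Fin n) (Fin w) ℝ | ¬ GoodSketch (Z y.1) r y.2} :=
    (measurable_goodSketch (hZ.comp measurable_fst) measurable_snd r).compl
  have := Measure.isProbabilityMeasure_map (μ := P) hp.aemeasurable
  have h1 : P {ω | ¬ GoodSketch (Z (p ω)) r (W ω)} ≤ ENNReal.ofReal δ := by
    have e : P {ω | ¬ GoodSketch (Z (p ω)) r (W ω)} =
        (P.map fun ω => (p ω, W ω))
          {y : X × Matrix (Fin n) (Fin w) ℝ | ¬ GoodSketch (Z y.1) r y.2} :=
      (Measure.map_apply (hp.prodMk h.1) hB).symm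
    -- By independence the joint law is a product; for each value of `p` the inner integral is the
    -- fixed-matrix failure probability.
    rw [e, (indepFun_iff_map_prod_eq_prod_map_map hp.aemeasurable h.1.aemeasurable).mp hind,
      Measure.prod_apply hB]
    calc _ ≤ ∫⁻ _, ENNReal.ofReal δ ∂(P.map p) := by
          refine lintegral_mono fun x => ?_
          rw [Measure.map_apply h.1 (measurable_prodMk_left hB)]
          exact (ENNReal.le_ofReal_iff_toReal_le (measure_ne_top _ _) hδ).mpr
            (h.measure_not_goodSketch_le (Z x))
      _ = ENNReal.ofReal δ := by simp
  exact ENNReal.toReal_le_of_le_ofReal hδ h1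

end Probability

/-! ### Convergence on the good event -/

/-- The alternative `μ ≤ tol` is needed because the iterate freezes once the loop has ended, and the
geometric bound may fail from then on. -/
theorem ipm_mem_neighborhood_and_le {m n w : ℕ} {A : Matrix (Fin m) (Fin n) ℝ} {b : Fin m → ℝ}
    {c : Fin n → ℝ} {γ σ ζ tol ρ : ℝ} {alg : Solver} {t : ℕ} {start : Triplet m n}
    {W : ℕ → Matrix (Fin n) (Fin w) ℝ} (hρ : 0 ≤ ρ) (hstart : start ∈ neighborhood A b c γ) {K : ℕ}
    (hstep : ∀ k < K, ipm A b c γ σ ζ alg t tol W start k ∈ neighborhood A b c γ →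
      outerStep A b c γ σ ζ alg t (W k) (ipm A b c γ σ ζ alg t tol W start k)
          ∈ neighborhood A b c γ ∧
        dualityMeasure
            (outerStep A b c γ σ ζ alg t (W k) (ipm A b c γ σ ζ alg t tol W start k)) ≤
          ρ * dualityMeasure (ipm A b c γ σ ζ alg t tol W start k)) :
    ∀ k ≤ K, ipm A b c γ σ ζ alg t tol W start k ∈ neighborhood A b c γ ∧
      (dualityMeasure (ipm A b c γ σ ζ alg t tol W start k) ≤ tol ∨
        dualityMeasure (ipm A b c γ σ ζ alg t tol W start k) ≤ ρ ^ k * dualityMeasure start) := by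
  intro k
  induction k with
  | zero => exact fun _ => ⟨hstart, Or.inr (by simp [ipm])⟩
  | succ k ih =>
    intro hk
    obtain ⟨h1, h2⟩ := ih (Nat.le_of_succ_le hk)
    obtain ⟨h3, h4⟩ := hstep k hk h1
    simp only [ipm]
    split_ifs with h
    · refine ⟨h3, Or.inr (h4.trans ?_)⟩
      rw [pow_succ', mul_assoc]
      exact mul_le_mul_of_nonneg_left (h2.resolve_left h.not_ge) hρ
    · exact ⟨h1, Or.inl (not_lt.mp h)⟩

theorem one_sub_div_pow_le {κ n ε : ℝ} {K : ℕ} (hκ : 0 < κ) (hκ1 : κ ≤ 1) (hn : 1 ≤ n) (hε : 0 < ε)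
    (hK : 1 / κ * n * Real.log (1 / ε) ≤ K) : (1 - κ / n) ^ K ≤ ε := by
  have hn0 : 0 < n := by linarith
  have h0 : 0 ≤ 1 - κ / n := by
    rw [sub_nonneg, div_le_one hn0]; linarith
  have h1 : 1 - κ / n ≤ Real.exp (-(κ / n)) := by
    have := Real.add_one_le_exp (-(κ / n)); linarith
  calc (1 - κ / n) ^ K ≤ Real.exp (-(κ / n)) ^ K := pow_le_pow_left₀ h0 h1 K
    _ = Real.exp (K * -(κ / n)) := (Real.exp_nat_mul _ _).symm
    _ ≤ Real.exp (Real.log ε) := by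
        refine Real.exp_le_exp.mpr ?_
        have h2 := mul_le_mul_of_nonneg_left hK (div_pos hκ hn0).le
        have e : κ / n * (1 / κ * n * Real.log (1 / ε)) = -Real.log ε := by
          rw [one_div ε, Real.log_inv]; field_simp
        rw [e] at h2
        linarith
    _ = ε := Real.exp_log hε

end SketchedIPM

/-! ### The main theorem: union bound over the passes -/

open SketchedIPM
theorem theorem1 (γ σ : ℝ) (hγ0 : 0 < γ) (hγ1 : γ < 1) (hσ0 : 0 < σ) (hσ1 : σ < 4 / 5) :
    -- constants that depend on `γ` and `σ` only
    ∃ Cin Cout cfail : ℝ, 0 < Cin ∧ 0 < Cout ∧ 0 < cfail ∧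
      ∀ (alg : Solver) (m n w : ℕ) (A : Matrix (Fin m) (Fin n) ℝ) (b : Fin m → ℝ)
        (c : Fin n → ℝ) (start : Triplet m n) (ε tol δ : ℝ) (t : ℕ),
        A.rank = m →
        start ∈ neighborhood A b c γ →
        0 < ε → ε ≤ 1 →
        -- covers the tolerance `ε * μ₀`, and the tolerance `ε` when `μ₀ ≤ 1`
        ε * dualityMeasure start ≤ tol →
        -- in particular `t = O(log n)` inner iterations
        Cin * (1 + Real.log n) ≤ t →
        -- `δ = O(1 / n)` for constant `ε`
        δ ≤ cfail / (n * (1 + Real.log (1 / ε))) →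
        ∀ {Ω : Type*} [MeasurableSpace Ω] (P : Measure Ω) [IsProbabilityMeasure P]
          (W : ℕ → Ω → Matrix (Fin n) (Fin w) ℝ),
          iIndepFun W P →
          (∀ k, IsSketchingMatrix P (W k) (1 / 2) δ m) →
          ∃ E : Set Ω, MeasurableSet E ∧ 9 / 10 ≤ P.real E ∧
            ∀ ω ∈ E, ∃ k : ℕ, k ≤ ⌈Cout * n * Real.log (1 / ε)⌉₊ ∧
              ipm A b c γ σ (1 / 2) alg t tol (fun j => W j ω) start k
                ∈ neighborhood A b c γ ∧
              dualityMeasure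
                (ipm A b c γ σ (1 / 2) alg t tol (fun j => W j ω) start k) ≤ tol := by
  obtain ⟨C, hC0, hC⟩ := exists_outerStep_constant hγ0 hγ1 hσ0 hσ1
  have hκ := decreaseRate_pos hγ0 hγ1 hσ0 hσ1
  have hκ1 := decreaseRate_le_one hγ0 hγ1 hσ0 hσ1
  set κ := decreaseRate γ σ
  -- `cfail` is chosen so that `K` passes with two events of probability at most `δ` each fail with
  -- probability at most `2Kδ ≤ 1/10`, given `K ≤ (1/κ + 1) n (1 + log (1/ε))`.
  refine ⟨C, 1 / κ, 1 / (20 * (1 / κ + 1)), hC0, by positivity, by positivity, ?_⟩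
  intro alg m n w A b c start ε tol δ t hA hstart hε hε1 htol ht hδ Ω _ P _ W hind hW
  rcases Nat.eq_zero_or_pos n with rfl | hn
  -- For `n = 0` the duality measure is `0` and `tol ≥ 0`, so the starting point already qualifies.
  · refine ⟨Set.univ, MeasurableSet.univ, by norm_num, fun ω _ => ⟨0, Nat.zero_le _, hstart, ?_⟩⟩
    have h0 : dualityMeasure start = 0 := by simp [dualityMeasure]
    rw [h0, mul_zero] at htol
    simpa only [ipm, h0] using htol
  have : NeZero n := ⟨hn.ne'⟩
  have hn1 : (1 : ℝ) ≤ n := by exact_mod_cast hn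
  have hlog : 0 ≤ Real.log (1 / ε) := Real.log_nonneg ((one_le_div hε).mpr hε1)
  set K := ⌈1 / κ * n * Real.log (1 / ε)⌉₊ with hK
  let it : ℕ → Ω → Triplet m n := fun k ω =>
    ipm A b c γ σ (1 / 2) alg t tol (fun j => W j ω) start k
  have hWm : ∀ k, Measurable (W k) := fun k => (hW k).1
  have hit : ∀ k, Measurable (it k) := fun k =>
    measurable_ipm A b c γ σ (1 / 2) alg t tol start hWm k
  let Z : Triplet m n → Matrix (Fin m) (Fin n) ℝ := fun p => orthonormalRows (A * scaling p)
  have hZ : Measurable Z := by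
    have := measurable_matrix_mul (measurable_const (a := A)) (measurable_scaling (m := m))
    exact measurable_matrix_mul (measurable_invSqrtGram this) this
  let bad : ℕ → Set Ω := fun k => {ω | ¬ GoodSketch (Z (it k ω)) m (W k ω)} ∪
    {ω | ¬ GoodSketch (1 : Matrix (Fin n) (Fin n) ℝ) m (W k ω)}
  have hbadm : ∀ k, MeasurableSet (bad k) := fun k =>
    (measurable_goodSketch (hZ.comp (hit k)) (hWm k) m).compl.union
      (measurable_goodSketch measurable_const (hWm k) m).compl
  have hbad : ∀ k, P.real (bad k) ≤ 2 * δ := fun k => by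
    have h1 := (hW k).measure_not_goodSketch_le_of_indepFun (hit k)
      (indepFun_ipm A b c γ σ (1 / 2) alg t tol start hWm hind k) hZ
    have h2 := (hW k).measure_not_goodSketch_le (1 : Matrix (Fin n) (Fin n) ℝ)
    exact (measureReal_union_le _ _).trans (by linarith)
  have hBm : MeasurableSet (⋃ k ∈ Finset.range K, bad k) :=
    Finset.measurableSet_biUnion _ fun k _ => hbadm k
  refine ⟨(⋃ k ∈ Finset.range K, bad k)ᶜ, hBm.compl, ?_, fun ω hω => ?_⟩
  · rw [probReal_compl_eq_one_sub hBm]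
    have h1 : P.real (⋃ k ∈ Finset.range K, bad k) ≤ K * (2 * δ) := by
      refine (measureReal_biUnion_finset_le _ _).trans ?_
      refine (Finset.sum_le_sum fun k _ => hbad k).trans ?_
      simp
    -- The `+ 1` from rounding up is absorbed by `1 ≤ n`.
    have hKle : (K : ℝ) ≤ (1 / κ + 1) * (n * (1 + Real.log (1 / ε))) := by
      have h2 := (Nat.ceil_lt_add_one (a := 1 / κ * n * Real.log (1 / ε)) (by positivity)).le
      have h3 : 0 ≤ 1 / κ * n := by positivity
      have h4 : 0 ≤ n * Real.log (1 / ε) := by positivity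
      rw [← hK] at h2
      nlinarith
    have h3 : (K : ℝ) * δ ≤ 1 / 20 := by
      have hpos : 0 < n * (1 + Real.log (1 / ε)) := by positivity
      have hδ0 : 0 ≤ 1 / (20 * (1 / κ + 1)) / (n * (1 + Real.log (1 / ε))) := by positivity
      calc (K : ℝ) * δ ≤ K * (1 / (20 * (1 / κ + 1)) / (n * (1 + Real.log (1 / ε)))) :=
            mul_le_mul_of_nonneg_left hδ (Nat.cast_nonneg K)
        _ ≤ (1 / κ + 1) * (n * (1 + Real.log (1 / ε))) *
              (1 / (20 * (1 / κ + 1)) / (n * (1 + Real.log (1 / ε)))) :=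
            mul_le_mul_of_nonneg_right hKle hδ0
        _ = 1 / 20 := by field_simp
    linarith
  · have hgood : ∀ k < K, GoodSketch (Z (it k ω)) m (W k ω) ∧
        GoodSketch (1 : Matrix (Fin n) (Fin n) ℝ) m (W k ω) := by
      intro k hk
      by_contra hcon
      refine hω (Set.mem_biUnion (Finset.mem_coe.mpr (Finset.mem_range.mpr hk)) ?_)
      rcases not_and_or.mp hcon with h | h
      · exact Or.inl h
      · exact Or.inr h
    have hρ : 0 ≤ 1 - κ / n := by
      rw [sub_nonneg, div_le_one (by linarith)]; linarith
    obtain ⟨h1, h2⟩ := ipm_mem_neighborhood_and_le hρ hstart (fun k hk hmem =>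
      hC alg m n w t m A b c _ (W k ω) hA hmem ht (hgood k hk).1 (hgood k hk).2) K le_rfl
    -- Either the loop has already ended below `tol`, or `K` contractions give `(1 - κ/n)^K μ₀ ≤ ε
    -- μ₀ ≤ tol`.
    refine ⟨K, le_rfl, h1, h2.elim id fun h3 => h3.trans (le_trans ?_ htol)⟩
    exact mul_le_mul_of_nonneg_right (one_sub_div_pow_le hκ hκ1 hn1 hε (Nat.le_ceil _))
      (dualityMeasure_nonneg hstart.1)
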